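/- Let $W:\{0,1\}\to\mathcal Y$ be a binary-input discrete memoryless channel with finite output alphabet that is symmetric, i.e. there is a permutation $\pi=\pi^{-1}$ of $\mathcal Y$ with $W(y|0)=W(\pi(y)|1)$ for all $y$. Let $I(W)$ be the mutual information (in bits) between input and output for a uniform input, let $Z(W)=\sum_{y}\sqrt{W(y|0)W(y|1)}$, and assume $0<I(W)<1$. Let $\ell\ge 2$ and let $G$ be an invertible $\ell\times\ell$ matrix over $\mathrm{GF}(2)$ with rows $g_1,\dots,g_\ell$. For $1\le i\le\ell$ let $W^{(i)}:\{0,1\}\to\mathcal Y^\ell\times\{0,1\}^{i-1}$ be the channel $$W^{(i)}(y_1^\ell,u_1^{i-1}\mid u_i)=\frac1{2^{\ell-1}}\sum_{u_{i+1}^\ell}\prod_{k=1}^\ell W\bigl(y_k\mid (u_1^\ell G)_k\bigr).$$ Let $B_1,B_2,\dots$ be i.i.d. uniform on $\{1,\dots,\ell\}$, let $W_0=W$, $W_{n+1}=W_n^{(B_{n+1})}$, and $Z_n=Z(W_n)$. Let $D_i=d_H(g_i,\langle g_{i+1},\dots,g_\ell\rangle)$ for $i<\ell$ and $D_\ell=d_H(g_\ell,0)$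 be the partial distances of $G$, where $d_H$ is the Hamming distance and $\langle\cdot\rangle$ the linear span, and put $$E(G)=\frac1\ell\sum_{i=1}^\ell\log_\ell D_i .$$ Then: (a) If $E(G)>0$, the rate of polarization of $G$ is $E(G)$, that is: (i) for every fixed real $\beta<E(G)$, $\lim_{n\to\infty}\Pr[Z_n\le 2^{-\ell^{n\beta}}]=I(W)$; and (ii) for every fixed $\beta>E(G)$, $\lim_{n\to\infty}\Pr[Z_n\ge 2^{-\ell^{n\beta}}]=1$. (b) If $E(G)=0$ (all $D_i=1$), (ii) still holds. -/

import Mathlib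

open MeasureTheory ProbabilityTheory Filter Topology Matrix

universe u v

noncomputable section

/-- A binary-input discrete memoryless channel `W : {0,1} → Out`, with a finite output alphabet;
`prob y x` is the transition probability `W(y|x)`. The input alphabet `{0,1}` is `ZMod 2`. -/
structure BDMC : Type (u + 1) where
  Out : Type u
  [fintypeOut : Fintype Out]
  prob : Out → ZMod 2 → ℝ
  prob_nonneg : ∀ y x, 0 ≤ prob y x
  sum_prob : ∀ x, ∑ y, prob y x = 1

attribute [instance] BDMC.fintypeOut

namespace BDMC

/-- `W` is symmetric: an involution `π` of the output alphabet satisfies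
`W(y|0) = W(π(y)|1)` for all `y`. -/
def IsSymmetric (W : BDMC.{u}) : Prop :=
  ∃ π : Equiv.Perm W.Out, (∀ y, π (π y) = y) ∧ ∀ y, W.prob y 0 = W.prob (π y) 1

/-- The mutual information `I(W)` (in bits) between the output of `W` and a uniformly
distributed input. -/
def mutualInfo (W : BDMC.{u}) : ℝ :=
  ∑ y, ∑ x : ZMod 2, (1 / 2) * W.prob y x *
    Real.logb 2 (W.prob y x / ((1 / 2) * W.prob y 0 + (1 / 2) * W.prob y 1))

/-- The Bhattacharyya parameter `Z(W) = ∑ y, √(W(y|0) W(y|1))`. -/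
def bhattacharyya (W : BDMC.{u}) : ℝ :=
  ∑ y, Real.sqrt (W.prob y 0 * W.prob y 1)

/-- The transition probability `W_ℓ(y | u) = ∏ k, W(y_k | (uG)_k)`. -/
def combined {ℓ : ℕ} (W : BDMC.{u}) (G : Matrix (Fin ℓ) (Fin ℓ) (ZMod 2))
    (y : Fin ℓ → W.Out) (u : Fin ℓ → ZMod 2) : ℝ :=
  ∏ k, W.prob (y k) ((u ᵥ* G) k)

/-- The transition probability of the `i`-th bit channel: input `x = u_i`, output `(y, p)` with
`p = (u_j)_{j < i}`. The sum over `(u_j)_{j > i}` is written as the sum over all vectors `u` whose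
entries up to `i` are the given ones. -/
def splitProb {ℓ : ℕ} (W : BDMC.{u}) (G : Matrix (Fin ℓ) (Fin ℓ) (ZMod 2)) (i : Fin ℓ)
    (o : (Fin ℓ → W.Out) × ({j : Fin ℓ // j < i} → ZMod 2)) (x : ZMod 2) : ℝ :=
  (1 / 2 ^ (ℓ - 1)) *
    ∑ u : Fin ℓ → ZMod 2 with (∀ j : {j : Fin ℓ // j < i}, u j = o.2 j) ∧ u i = x,
      W.combined G o.1 u

theorem splitProb_nonneg {ℓ : ℕ} (W : BDMC.{u}) (G : Matrix (Fin ℓ) (Fin ℓ) (ZMod 2))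
    (i : Fin ℓ) (o : (Fin ℓ → W.Out) × ({j : Fin ℓ // j < i} → ZMod 2)) (x : ZMod 2) :
    0 ≤ W.splitProb G i o x :=
  mul_nonneg (by positivity)
    (Finset.sum_nonneg fun _ _ => Finset.prod_nonneg fun _ _ => W.prob_nonneg _ _)

theorem sum_combined {ℓ : ℕ} (W : BDMC.{u}) (G : Matrix (Fin ℓ) (Fin ℓ) (ZMod 2))
    (u : Fin ℓ → ZMod 2) : ∑ y, W.combined G y u = 1 := by
  classical
  unfold combined
  rw [← Fintype.prod_sum (fun k y => W.prob y ((u ᵥ* G) k))]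
  simp [W.sum_prob]

theorem card_fixed {ℓ : ℕ} (i : Fin ℓ) (x : ZMod 2) :
    (Finset.univ.filter fun u : Fin ℓ → ZMod 2 => u i = x).card = 2 ^ (ℓ - 1) := by
  classical
  have h := Fintype.card_filter_piFinset_eq_of_mem
    (fun _ : Fin ℓ => (Finset.univ : Finset (ZMod 2))) i (Finset.mem_univ x)
  simpa [ZMod.card, Finset.prod_const, Finset.card_erase_of_mem] using h

theorem sum_splitProb {ℓ : ℕ} (W : BDMC.{u}) (G : Matrix (Fin ℓ) (Fin ℓ) (ZMod 2))
    (i : Fin ℓ) (x : ZMod 2) : ∑ o, W.splitProb G i o x = 1 := by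
  classical
  unfold splitProb
  rw [← Finset.mul_sum, Fintype.sum_prod_type]
  have key : ∀ y : Fin ℓ → W.Out,
      (∑ p : {j : Fin ℓ // j < i} → ZMod 2,
        ∑ u : Fin ℓ → ZMod 2 with (∀ j : {j : Fin ℓ // j < i}, u j = p j) ∧ u i = x,
          W.combined G y u) =
      ∑ u : Fin ℓ → ZMod 2 with u i = x, W.combined G y u := by
    intro y
    simp_rw [Finset.sum_filter]
    rw [Finset.sum_comm]
    refine Finset.sum_congr rfl fun u _ => ?_
    rw [Finset.sum_eq_single (fun j : {j : Fin ℓ // j < i} => u j)]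
    · simp
    · intro p _ hp
      rw [if_neg]
      rintro ⟨h, _⟩
      exact hp (funext fun j => (h j).symm)
    · simp
  simp only [key]
  rw [Finset.sum_comm]
  simp only [sum_combined, Finset.sum_const, nsmul_eq_mul, mul_one]
  rw [card_fixed]
  push_cast
  rw [one_div, inv_mul_cancel₀ (by positivity)]

/-- The `i`-th bit channel `W^{(i)} : {0,1} → Out^ℓ × {0,1}^{i-1}` obtained from `W` and `G`. -/
def split {ℓ : ℕ} (W : BDMC.{u}) (G : Matrix (Fin ℓ) (Fin ℓ) (ZMod 2)) (i : Fin ℓ) :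
    BDMC.{u} where
  Out := (Fin ℓ → W.Out) × ({j : Fin ℓ // j < i} → ZMod 2)
  prob := W.splitProb G i
  prob_nonneg := W.splitProb_nonneg G i
  sum_prob := W.sum_splitProb G i

/-- The tree process along a branch `b`: `W_0 = W`, `W_{n+1} = W_n^{(b_{n+1})}`
(with `b` indexed from `0`). -/
def tree {ℓ : ℕ} (W : BDMC.{u}) (G : Matrix (Fin ℓ) (Fin ℓ) (ZMod 2)) (b : ℕ → Fin ℓ) :
    ℕ → BDMC.{u}
  | 0 => W
  | n + 1 => (W.tree G b n).split G (b n)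

end BDMC

/-- `B` is a sequence of independent random variables, each uniformly distributed on
the `ℓ` row indices. -/
structure IsUniformIID {Ω : Type v} [MeasurableSpace Ω] {ℓ : ℕ} (μ : Measure Ω)
    (B : ℕ → Ω → Fin ℓ) : Prop where
  measurable : ∀ n, Measurable (B n)
  indep : iIndepFun B μ
  uniform : ∀ n i, μ.real {ω | B n ω = i} = 1 / (ℓ : ℝ)

/-- The random variable `Z_n = Z(W_n)` of the tree process driven by `B`. -/
def bhattacharyyaProcess {Ω : Type v} {ℓ : ℕ} (B : ℕ → Ω → Fin ℓ) (W : BDMC.{u})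
    (G : Matrix (Fin ℓ) (Fin ℓ) (ZMod 2)) (n : ℕ) (ω : Ω) : ℝ :=
  (W.tree G (fun k => B k ω) n).bhattacharyya

/-- The threshold `2^{-ℓ^{nβ}}`. -/
def rateThreshold (ℓ : ℕ) (β : ℝ) (n : ℕ) : ℝ :=
  (2 : ℝ) ^ (-((ℓ : ℝ) ^ ((n : ℝ) * β)))

/-- `G` has rate of polarization `E` for the channel `W`. -/
structure HasRateOfPolarization {Ω : Type v} [MeasurableSpace Ω] {ℓ : ℕ} (μ : Measure Ω)
    (B : ℕ → Ω → Fin ℓ) (W : BDMC.{u}) (G : Matrix (Fin ℓ) (Fin ℓ) (ZMod 2)) (E : ℝ) :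
    Prop where
  achievable : ∀ β : ℝ, β < E →
    Tendsto (fun n => μ.real {ω | bhattacharyyaProcess B W G n ω ≤ rateThreshold ℓ β n})
      atTop (𝓝 W.mutualInfo)
  converse : ∀ β : ℝ, E < β →
    Tendsto (fun n => μ.real {ω | rateThreshold ℓ β n ≤ bhattacharyyaProcess B W G n ω})
      atTop (𝓝 1)

/-- The partial distance `D_i`: the minimum Hamming distance between row `i` of `G` and the
linear code spanned by the rows below it (the zero code for the last row). -/
def partialDistance {ℓ : ℕ} (G : Matrix (Fin ℓ) (Fin ℓ) (ZMod 2)) (i : Fin ℓ) : ℕ :=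
  sInf {d | ∃ c ∈ Submodule.span (ZMod 2) (G.row '' Set.Ioi i), hammingDist (G.row i) c = d}

/-- `E(G) = (1/ℓ) ∑ i, log_ℓ D_i`. -/
def polarExponent {ℓ : ℕ} (G : Matrix (Fin ℓ) (Fin ℓ) (ZMod 2)) : ℝ :=
  (1 / (ℓ : ℝ)) * ∑ i, Real.logb ℓ (partialDistance G i)

end

noncomputable section

/-! The asymptotics are studied path by path. One step satisfies `Z ^ D_i ≤ Z(W^(i)) ≤ 2 ^ ℓ * Z ^
D_i`: the lower bound is Cauchy–Schwarz along a shift attaining `D_i`, the upper one is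
subadditivity of the square root. By the strong law the average of `log_ℓ D_{B_k}` tends to `E(G)`
almost surely. Iterating the lower bound therefore gives the converse for every invertible `G`;
iterating the upper one gives the rate `E(G)` on each path with `Z_n → 0`, because the constant `2 ^
ℓ` becomes negligible once `Z_n` is small.

It remains to find the probability of these paths. By the chain rule `I(W_n)` is a bounded
martingale, so it converges to some `J` of mean `I(W)`, and it suffices that `J` is `0` or `1`
almost surely. If `E(G) > 0`, a pigeonhole argument gives two distinct unit vectors whose preimages
under `u ↦ uG` have the same leading position `i` (`exists_two_unit_vectors`). The posterior bias of
bit `i` is then at most the product of the biases at those two coordinates (`abs_bias_split_le`),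
whence `I(W^(i)) ≤ T(W) * I(W)` with `T` the total variation. Row `i` is chosen infinitely often, so
a limit `J` in `(0, 1)` would push `T(W_n)`, and with it `I(W_n)`, towards `1` along a subsequence.

On `J = 0` the convergence `Z_n → 1` is not enough, since for negative `β` the thresholds tend to
`1` too. The same product bound gives `1 - Z(W^(i)) ≤ 4 * (1 - Z) ^ 2`, while any other row costs at
most a factor `ℓ`; hence `1 - Z_n` decays doubly exponentially. -/

theorem sum_zmod_two {M : Type*} [AddCommMonoid M] (f : ZMod 2 → M) : ∑ x, f x = f 0 + f 1 :=
  Fin.sum_univ_two f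

/-! ### The capacity function of the binary symmetric channel -/

/-- The capacity (in bits) of the binary symmetric channel with crossover probability
`(1 - t) / 2`. -/
def bscCapacity (t : ℝ) : ℝ := 1 - Real.binEntropy ((1 + t) / 2) / Real.log 2

theorem bscCapacity_one : bscCapacity 1 = 1 := by simp [bscCapacity]

theorem bscCapacity_neg_one : bscCapacity (-1) = 1 := by simp [bscCapacity]

theorem bscCapacity_zero : bscCapacity 0 = 0 := by
  have : Real.log 2 ≠ 0 := (Real.log_pos one_lt_two).ne'
  simp [bscCapacity, div_self this]

theorem bscCapacity_neg (t : ℝ) : bscCapacity (-t) = bscCapacity t := by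
  unfold bscCapacity
  rw [← Real.binEntropy_one_sub]
  ring_nf

theorem bscCapacity_abs (t : ℝ) : bscCapacity |t| = bscCapacity t := by
  rcases abs_choice t with h | h <;> simp [h, bscCapacity_neg]

theorem bscCapacity_nonneg (t : ℝ) : 0 ≤ bscCapacity t := by
  have h := Real.binEntropy_le_log_two (p := (1 + t) / 2)
  have := (div_le_one (Real.log_pos one_lt_two)).2 h
  unfold bscCapacity; linarith

theorem bscCapacity_pos {t : ℝ} (ht : t ≠ 0) : 0 < bscCapacity t := by
  have h : Real.binEntropy ((1 + t) / 2) < Real.log 2 := by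
    rw [Real.binEntropy_lt_log_two]
    intro h
    apply ht
    linarith
  have := (div_lt_one (Real.log_pos one_lt_two)).2 h
  unfold bscCapacity; linarith

theorem continuous_bscCapacity : Continuous bscCapacity := by
  unfold bscCapacity
  exact continuous_const.sub
    ((Real.binEntropy_continuous.comp (by fun_prop)).div_const _)

theorem convexOn_bscCapacity : ConvexOn ℝ (Set.Icc (-1) 1) bscCapacity := by
  refine ⟨convex_Icc _ _, ?_⟩
  intro x hx y hy a b ha hb hab
  have h := Real.strictConcave_binEntropy.concaveOn.2 (x := (1 + x) / 2) (y := (1 + y) / 2)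
    ⟨by linarith [hx.1], by linarith [hx.2]⟩ ⟨by linarith [hy.1], by linarith [hy.2]⟩ ha hb hab
  have h2 : (1 + (a • x + b • y)) / 2 = a • ((1 + x) / 2) + b • ((1 + y) / 2) := by
    simp only [smul_eq_mul]
    linear_combination (-1 / 2) * hab
  have hl := Real.log_pos one_lt_two
  unfold bscCapacity
  rw [h2]
  have h3 := div_le_div_of_nonneg_right h hl.le
  simp only [smul_eq_mul] at h3 ⊢
  have h4 : ∀ u v : ℝ, a * (1 - u / Real.log 2) + b * (1 - v / Real.log 2) =
      1 - (a * u + b * v) / Real.log 2 := by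
    intro u v
    rw [add_div]
    linear_combination hab
  rw [h4]
  linarith

/-- Convexity on the segment from `0`, where the capacity vanishes, to `|t|`. This later splits the
capacity at a product of biases into a product of averages. -/
theorem bscCapacity_mul_le {s t : ℝ} (hs : |s| ≤ 1) (ht : |t| ≤ 1) :
    bscCapacity (s * t) ≤ |s| * bscCapacity t := by
  have h := convexOn_bscCapacity.2 (x := |t|) (y := 0) ⟨by linarith [abs_nonneg t], ht⟩ (by norm_num)
    (abs_nonneg s) (sub_nonneg.2 hs) (by ring)
  rw [← bscCapacity_abs (s * t), abs_mul, ← bscCapacity_abs t]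
  simpa [bscCapacity_zero] using h

theorem bscCapacity_le_abs {t : ℝ} (ht : |t| ≤ 1) : bscCapacity t ≤ |t| := by
  simpa [bscCapacity_one] using bscCapacity_mul_le (s := t) (t := 1) ht (by simp)

theorem bscCapacity_mono {s t : ℝ} (hst : |s| ≤ |t|) (ht : |t| ≤ 1) :
    bscCapacity s ≤ bscCapacity t := by
  rcases eq_or_ne t 0 with rfl | h0
  · have : s = 0 := by simpa using hst
    rw [this]
  · have h1 : |s / t| ≤ 1 := by
      rw [abs_div]; exact (div_le_one (abs_pos.2 h0)).2 hst
    have h := bscCapacity_mul_le h1 ht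
    rw [div_mul_cancel₀ _ h0] at h
    exact h.trans (mul_le_of_le_one_left (bscCapacity_nonneg _) h1)

theorem mul_log_div_eq {a c : ℝ} (ha : 0 ≤ a) (hc : a ≠ 0 → 0 < c) :
    a * Real.log (a / c) = a * Real.log a - a * Real.log c := by
  rcases eq_or_ne a 0 with rfl | h
  · simp
  · rw [Real.log_div h (hc h).ne']; ring

/-- The common normal form, in terms `x log x`, of the mutual information summand here and of the
capacity summand in `half_mul_bscCapacity_eq`. The conventions for `log 0` and `0 / 0` make it valid
at zero probabilities. -/
theorem half_mul_logb_add_eq {a b : ℝ} (ha : 0 ≤ a) (hb : 0 ≤ b) :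
    (1 / 2) * a * Real.logb 2 (a / ((1 / 2) * a + (1 / 2) * b)) +
      (1 / 2) * b * Real.logb 2 (b / ((1 / 2) * a + (1 / 2) * b)) =
    (a * Real.log a + b * Real.log b - (a + b) * Real.log (a + b)) / (2 * Real.log 2) +
      (a + b) / 2 := by
  have hl := (Real.log_pos one_lt_two).ne'
  rcases eq_or_ne (a + b) 0 with h | h
  · obtain ⟨rfl, rfl⟩ : a = 0 ∧ b = 0 := ⟨by linarith, by linarith⟩
    simp
  have hp : 0 < a + b := lt_of_le_of_ne (by positivity) h.symm
  have h1 : (1 / 2) * a + (1 / 2) * b = (a + b) / 2 := by ring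
  have h2 := mul_log_div_eq ha (c := (a + b) / 2) fun _ => by positivity
  have h3 := mul_log_div_eq hb (c := (a + b) / 2) fun _ => by positivity
  rw [Real.log_div h two_ne_zero] at h2 h3
  rw [h1]
  have h4 : ∀ X Y : ℝ, 1 / 2 * a * Real.logb 2 X + 1 / 2 * b * Real.logb 2 Y =
      (a * Real.log X + b * Real.log Y) / (2 * Real.log 2) := by
    intro X Y
    simp only [Real.logb]
    field_simp
  rw [h4, h2, h3]
  field_simp
  ring

theorem half_mul_bscCapacity_eq {a b : ℝ} (ha : 0 ≤ a) (hb : 0 ≤ b) :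
    (a + b) / 2 * bscCapacity ((a - b) / (a + b)) =
    (a * Real.log a + b * Real.log b - (a + b) * Real.log (a + b)) / (2 * Real.log 2) +
      (a + b) / 2 := by
  have hl := (Real.log_pos one_lt_two).ne'
  rcases eq_or_ne (a + b) 0 with h | h
  · obtain ⟨rfl, rfl⟩ : a = 0 ∧ b = 0 := ⟨by linarith, by linarith⟩
    simp
  have hp : 0 < a + b := lt_of_le_of_ne (by positivity) h.symm
  have h1 : (1 + (a - b) / (a + b)) / 2 = a / (a + b) := by field_simp; ring
  have h1' : 1 - a / (a + b) = b / (a + b) := by field_simp; ring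
  have h2 := mul_log_div_eq ha (c := a + b) fun _ => hp
  have h3 := mul_log_div_eq hb (c := a + b) fun _ => hp
  rw [bscCapacity, h1, Real.binEntropy, h1', Real.log_inv, Real.log_inv]
  field_simp
  linear_combination h2 + h3

/-! ### Channel parameters as averages over the posterior bias -/

namespace BDMC

variable (W : BDMC.{u})

/-- The probability of the output `y` under a uniform input. -/
def outProb (y : W.Out) : ℝ := (W.prob y 0 + W.prob y 1) / 2

/-- The difference of the posterior probabilities of the two inputs given the output `y`. -/
def bias (y : W.Out) : ℝ := (W.prob y 0 - W.prob y 1) / (W.prob y 0 + W.prob y 1)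

/-- The total variation distance between the two output distributions. -/
def totalVariation : ℝ := ∑ y, W.outProb y * |W.bias y|

theorem outProb_nonneg (y : W.Out) : 0 ≤ W.outProb y := by
  have := W.prob_nonneg y 0
  have := W.prob_nonneg y 1
  unfold outProb; positivity

theorem sum_outProb : ∑ y, W.outProb y = 1 := by
  simp [outProb, ← Finset.sum_div, Finset.sum_add_distrib, W.sum_prob]

theorem abs_bias_le_one (y : W.Out) : |W.bias y| ≤ 1 := by
  have h0 := W.prob_nonneg y 0
  have h1 := W.prob_nonneg y 1
  rw [bias, abs_div, abs_of_nonneg (by positivity : 0 ≤ W.prob y 0 + W.prob y 1)]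
  refine div_le_one_of_le₀ ?_ (by positivity)
  rw [abs_le]
  constructor <;> linarith

theorem prob_zero_add_prob_one (y : W.Out) : W.prob y 0 + W.prob y 1 = 2 * W.outProb y := by
  unfold outProb; ring

theorem prob_zero_sub_prob_one (y : W.Out) :
    W.prob y 0 - W.prob y 1 = 2 * W.outProb y * W.bias y := by
  have h0 := W.prob_nonneg y 0
  have h1 := W.prob_nonneg y 1
  unfold outProb bias
  rcases eq_or_ne (W.prob y 0 + W.prob y 1) 0 with h | h
  -- An output of probability zero has bias `0 / 0 = 0`, so it needs no exception.
  · have : W.prob y 0 = 0 := by linarith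
    have : W.prob y 1 = 0 := by linarith
    simp [*]
  · field_simp

theorem prob_zero_eq (y : W.Out) : W.prob y 0 = W.outProb y * (1 + W.bias y) := by
  linarith [W.prob_zero_add_prob_one y, W.prob_zero_sub_prob_one y]

theorem prob_one_eq (y : W.Out) : W.prob y 1 = W.outProb y * (1 - W.bias y) := by
  linarith [W.prob_zero_add_prob_one y, W.prob_zero_sub_prob_one y]

theorem mutualInfo_eq_sum_bscCapacity :
    W.mutualInfo = ∑ y, W.outProb y * bscCapacity (W.bias y) := by
  refine Finset.sum_congr rfl fun y _ => ?_
  rw [sum_zmod_two, half_mul_logb_add_eq (W.prob_nonneg y 0) (W.prob_nonneg y 1),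
    ← half_mul_bscCapacity_eq (W.prob_nonneg y 0) (W.prob_nonneg y 1), outProb, bias]

/-- The entropy form, in which the bit channels telescope in the chain rule. -/
theorem mutualInfo_eq_sum_log :
    W.mutualInfo = 1 + (∑ y, ∑ x, W.prob y x * Real.log (W.prob y x) -
      ∑ y, (W.prob y 0 + W.prob y 1) * Real.log (W.prob y 0 + W.prob y 1)) /
        (2 * Real.log 2) := by
  have : ∀ y, (∑ x : ZMod 2, (1 / 2) * W.prob y x *
      Real.logb 2 (W.prob y x / ((1 / 2) * W.prob y 0 + (1 / 2) * W.prob y 1))) =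
      (∑ x, W.prob y x * Real.log (W.prob y x) -
        (W.prob y 0 + W.prob y 1) * Real.log (W.prob y 0 + W.prob y 1)) / (2 * Real.log 2) +
      W.outProb y := fun y => by
    rw [sum_zmod_two, sum_zmod_two, half_mul_logb_add_eq (W.prob_nonneg y 0) (W.prob_nonneg y 1),
      outProb]
  unfold mutualInfo
  rw [Finset.sum_congr rfl fun y _ => this y, Finset.sum_add_distrib, sum_outProb,
    ← Finset.sum_div, Finset.sum_sub_distrib]
  ring

theorem bhattacharyya_eq : W.bhattacharyya = ∑ y, W.outProb y * √(1 - W.bias y ^ 2) := by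
  refine Finset.sum_congr rfl fun y _ => ?_
  rw [prob_zero_eq, prob_one_eq]
  have : W.outProb y * (1 + W.bias y) * (W.outProb y * (1 - W.bias y)) =
      W.outProb y ^ 2 * (1 - W.bias y ^ 2) := by ring
  rw [this, Real.sqrt_mul (sq_nonneg _), Real.sqrt_sq (W.outProb_nonneg y)]

theorem bias_sq_le_one (y : W.Out) : W.bias y ^ 2 ≤ 1 := by
  rw [← sq_abs]; exact pow_le_one₀ (abs_nonneg _) (W.abs_bias_le_one y)

theorem mutualInfo_nonneg : 0 ≤ W.mutualInfo := by
  rw [mutualInfo_eq_sum_bscCapacity]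
  exact Finset.sum_nonneg fun y _ => mul_nonneg (W.outProb_nonneg y) (bscCapacity_nonneg _)

theorem totalVariation_nonneg : 0 ≤ W.totalVariation :=
  Finset.sum_nonneg fun y _ => mul_nonneg (W.outProb_nonneg y) (abs_nonneg _)

theorem totalVariation_le_one : W.totalVariation ≤ 1 := by
  rw [← W.sum_outProb]
  exact Finset.sum_le_sum fun y _ =>
    mul_le_of_le_one_right (W.outProb_nonneg y) (W.abs_bias_le_one y)

theorem mutualInfo_le_totalVariation : W.mutualInfo ≤ W.totalVariation := by
  rw [mutualInfo_eq_sum_bscCapacity]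
  exact Finset.sum_le_sum fun y _ =>
    mul_le_mul_of_nonneg_left (bscCapacity_le_abs (W.abs_bias_le_one y)) (W.outProb_nonneg y)

theorem mutualInfo_le_one : W.mutualInfo ≤ 1 :=
  W.mutualInfo_le_totalVariation.trans W.totalVariation_le_one

/-- Jensen's inequality for the convex even function `bscCapacity` at the points `|bias|`. -/
theorem bscCapacity_totalVariation_le : bscCapacity W.totalVariation ≤ W.mutualInfo := by
  have h := convexOn_bscCapacity.map_sum_le (t := Finset.univ) (w := W.outProb)
    (p := fun y => |W.bias y|) (fun y _ => W.outProb_nonneg y) W.sum_outProb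
    (fun y _ => ⟨by linarith [abs_nonneg (W.bias y)], W.abs_bias_le_one y⟩)
  simp only [smul_eq_mul, bscCapacity_abs, ← mutualInfo_eq_sum_bscCapacity] at h
  exact h

theorem bhattacharyya_nonneg : 0 ≤ W.bhattacharyya :=
  Finset.sum_nonneg fun _ _ => Real.sqrt_nonneg _

/-- Jensen's inequality for the square, applied to `√(1 - bias ^ 2)` and to `|bias|`, whose squares
sum to `1`. -/
theorem bhattacharyya_sq_add_totalVariation_sq_le :
    W.bhattacharyya ^ 2 + W.totalVariation ^ 2 ≤ 1 := by
  have key : ∀ f : W.Out → ℝ, (∑ y, W.outProb y * f y) ^ 2 ≤ ∑ y, W.outProb y * f y ^ 2 :=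
    fun f => by
      simpa only [smul_eq_mul] using (even_two.convexOn_pow (𝕜 := ℝ)).map_sum_le
        (fun y _ => W.outProb_nonneg y) W.sum_outProb fun y _ => Set.mem_univ (f y)
  have hZ := key fun y => √(1 - W.bias y ^ 2)
  have hT := key fun y => |W.bias y|
  rw [← bhattacharyya_eq] at hZ
  refine (add_le_add hZ hT).trans ?_
  rw [← Finset.sum_add_distrib]
  refine (Finset.sum_le_sum fun y _ => ?_).trans_eq W.sum_outProb
  rw [Real.sq_sqrt (by linarith [W.bias_sq_le_one y]), sq_abs]
  linarith

theorem bhattacharyya_le_one : W.bhattacharyya ≤ 1 := by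
  nlinarith [W.bhattacharyya_sq_add_totalVariation_sq_le, W.bhattacharyya_nonneg,
    sq_nonneg W.totalVariation]

theorem one_sub_bhattacharyya_eq :
    1 - W.bhattacharyya = ∑ y, W.outProb y * (1 - √(1 - W.bias y ^ 2)) := by
  simp_rw [mul_sub, mul_one]
  rw [Finset.sum_sub_distrib, sum_outProb, ← bhattacharyya_eq]

theorem one_sub_sqrt_le_sq {t : ℝ} (ht : t ^ 2 ≤ 1) : 1 - √(1 - t ^ 2) ≤ t ^ 2 := by
  have h0 : 0 ≤ 1 - t ^ 2 := by linarith
  have h1 : √(1 - t ^ 2) ≤ 1 := Real.sqrt_le_one.2 (by nlinarith)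
  nlinarith [Real.sq_sqrt h0, Real.sqrt_nonneg (1 - t ^ 2)]

theorem sq_le_two_mul_one_sub_sqrt {t : ℝ} (ht : t ^ 2 ≤ 1) :
    t ^ 2 ≤ 2 * (1 - √(1 - t ^ 2)) := by
  have h0 : 0 ≤ 1 - t ^ 2 := by linarith
  nlinarith [Real.sq_sqrt h0, sq_nonneg (1 - √(1 - t ^ 2))]

theorem one_sub_bhattacharyya_le_totalVariation :
    1 - W.bhattacharyya ≤ W.totalVariation := by
  rw [one_sub_bhattacharyya_eq]
  refine Finset.sum_le_sum fun y _ => mul_le_mul_of_nonneg_left ?_ (W.outProb_nonneg y)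
  refine (one_sub_sqrt_le_sq (W.bias_sq_le_one y)).trans ?_
  have := W.abs_bias_le_one y
  rw [← sq_abs]
  nlinarith [abs_nonneg (W.bias y)]

theorem sum_outProb_mul_bias_sq_le :
    ∑ y, W.outProb y * W.bias y ^ 2 ≤ 2 * (1 - W.bhattacharyya) := by
  rw [one_sub_bhattacharyya_eq, Finset.mul_sum]
  refine Finset.sum_le_sum fun y _ => ?_
  nlinarith [mul_le_mul_of_nonneg_left (sq_le_two_mul_one_sub_sqrt (W.bias_sq_le_one y))
    (W.outProb_nonneg y)]

/-- If `Z = 0`, each output of positive probability has bias `±1`, hence capacity `1`. Positivity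
supplies the finite starting exponent of the converse. -/
theorem bhattacharyya_pos (hI : W.mutualInfo < 1) : 0 < W.bhattacharyya := by
  refine lt_of_le_of_ne W.bhattacharyya_nonneg fun h => hI.ne ?_
  rw [bhattacharyya_eq, eq_comm, Finset.sum_eq_zero_iff_of_nonneg fun y _ =>
    mul_nonneg (W.outProb_nonneg y) (Real.sqrt_nonneg _)] at h
  rw [mutualInfo_eq_sum_bscCapacity, ← W.sum_outProb]
  refine Finset.sum_congr rfl fun y hy => ?_
  rcases mul_eq_zero.1 (h y hy) with h | h
  · simp [h]
  · have h1 : W.bias y ^ 2 = 1 := by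
      have := (Real.sqrt_eq_zero (by linarith [W.bias_sq_le_one y])).1 h
      linarith
    rcases (sq_eq_sq_iff_eq_or_eq_neg.1 (h1.trans (one_pow 2).symm)) with h2 | h2 <;>
      simp [h2, bscCapacity_one, bscCapacity_neg_one]

end BDMC

/-! ### Partial distances and leading positions -/

theorem vecMul_mem_span_rows {ℓ : ℕ} (G : Matrix (Fin ℓ) (Fin ℓ) (ZMod 2)) (i : Fin ℓ)
    {a : Fin ℓ → ZMod 2} (ha : ∀ j ≤ i, a j = 0) :
    a ᵥ* G ∈ Submodule.span (ZMod 2) (G.row '' Set.Ioi i) := by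
  rw [Matrix.vecMul_eq_sum]
  refine Submodule.sum_mem _ fun j _ => ?_
  rcases le_or_gt j i with h | h
  · rw [ha j h, zero_smul]; exact Submodule.zero_mem _
  · exact Submodule.smul_mem _ _ (Submodule.subset_span ⟨j, h, rfl⟩)

theorem exists_vecMul_eq_of_mem_span_rows {ℓ : ℕ} (G : Matrix (Fin ℓ) (Fin ℓ) (ZMod 2))
    (i : Fin ℓ) {c : Fin ℓ → ZMod 2}
    (hc : c ∈ Submodule.span (ZMod 2) (G.row '' Set.Ioi i)) :
    ∃ a : Fin ℓ → ZMod 2, (∀ j ≤ i, a j = 0) ∧ a ᵥ* G = c := by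
  induction hc using Submodule.span_induction with
  | mem x hx =>
    obtain ⟨j, hj, rfl⟩ := hx
    refine ⟨Pi.single j 1, fun k hk => ?_, Matrix.single_one_vecMul j G⟩
    rw [Pi.single_apply, if_neg]
    rintro rfl
    exact absurd hk (not_le.2 hj)
  | zero => exact ⟨0, fun _ _ => rfl, Matrix.zero_vecMul G⟩
  | add x y _ _ hx hy =>
    obtain ⟨a, ha, rfl⟩ := hx
    obtain ⟨b, hb, rfl⟩ := hy
    exact ⟨a + b, fun j hj => by simp [ha j hj, hb j hj], Matrix.add_vecMul G a b⟩
  | smul r x _ hx =>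
    obtain ⟨a, ha, rfl⟩ := hx
    exact ⟨r • a, fun j hj => by simp [ha j hj], Matrix.smul_vecMul r a G⟩

/-- With `partialDistance_le_hammingNorm`, this describes `D_i` as the least weight of `aG` over the
vectors `a` with leading `1` at `i`. Adding such an `a` keeps the prefix and flips bit `i`. -/
theorem exists_hammingNorm_eq_partialDistance {ℓ : ℕ} (G : Matrix (Fin ℓ) (Fin ℓ) (ZMod 2))
    (i : Fin ℓ) : ∃ a : Fin ℓ → ZMod 2, (∀ j < i, a j = 0) ∧ a i = 1 ∧
      hammingNorm (a ᵥ* G) = partialDistance G i := by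
  have hne : {d | ∃ c ∈ Submodule.span (ZMod 2) (G.row '' Set.Ioi i),
      hammingDist (G.row i) c = d}.Nonempty := ⟨_, 0, Submodule.zero_mem _, rfl⟩
  obtain ⟨c, hc, hd⟩ := Nat.sInf_mem hne
  obtain ⟨a, ha, rfl⟩ := exists_vecMul_eq_of_mem_span_rows G i hc
  refine ⟨Pi.single i 1 - a, fun j hj => by simp [hj.ne, ha j hj.le], by simp [ha i le_rfl], ?_⟩
  rw [Matrix.sub_vecMul, Matrix.single_one_vecMul, sub_eq_neg_add, ← hammingDist_eq_hammingNorm,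
    hammingDist_comm]
  exact hd

theorem partialDistance_le_hammingNorm {ℓ : ℕ} (G : Matrix (Fin ℓ) (Fin ℓ) (ZMod 2))
    {i : Fin ℓ} {a : Fin ℓ → ZMod 2} (ha : ∀ j < i, a j = 0) (hi : a i = 1) :
    partialDistance G i ≤ hammingNorm (a ᵥ* G) := by
  refine Nat.sInf_le ⟨(Pi.single i 1 - a) ᵥ* G, vecMul_mem_span_rows G i fun j hj => ?_, ?_⟩
  · rcases hj.lt_or_eq with h | rfl
    · simp [h.ne, ha j h]
    · simp [hi]
  · rw [hammingDist_comm, hammingDist_eq_hammingNorm, Matrix.sub_vecMul, Matrix.single_one_vecMul]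
    congr 1
    change -(G.row i - a ᵥ* G) + G.row i = a ᵥ* G
    abel

theorem vecMul_bijective_of_isUnit {ℓ : ℕ} {G : Matrix (Fin ℓ) (Fin ℓ) (ZMod 2)}
    (hG : IsUnit G) : Function.Bijective fun u => u ᵥ* G :=
  Finite.injective_iff_bijective.1 (Matrix.vecMul_injective_of_isUnit hG)

theorem one_le_partialDistance {ℓ : ℕ} {G : Matrix (Fin ℓ) (Fin ℓ) (ZMod 2)} (hG : IsUnit G)
    (i : Fin ℓ) : 1 ≤ partialDistance G i := by
  obtain ⟨a, -, hi, h⟩ := exists_hammingNorm_eq_partialDistance G i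
  rw [← h, Nat.one_le_iff_ne_zero, hammingNorm_ne_zero_iff]
  intro h0
  have : a = 0 := Matrix.vecMul_injective_of_isUnit hG (by simpa using h0)
  simp [this] at hi

theorem partialDistance_le {ℓ : ℕ} (G : Matrix (Fin ℓ) (Fin ℓ) (ZMod 2)) (i : Fin ℓ) :
    partialDistance G i ≤ ℓ := by
  obtain ⟨a, -, -, h⟩ := exists_hammingNorm_eq_partialDistance G i
  rw [← h]
  simpa using hammingNorm_le_card_fintype (x := a ᵥ* G)

/-- If `G` has a non-zero exponent, then two distinct unit vectors lie in the same coset of the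
code spanned by the rows below some row. -/
theorem exists_two_unit_vectors {ℓ : ℕ} {G : Matrix (Fin ℓ) (Fin ℓ) (ZMod 2)} (hG : IsUnit G)
    (hE : polarExponent G ≠ 0) : ∃ (i k₀ k₁ : Fin ℓ) (a₀ a₁ : Fin ℓ → ZMod 2), k₀ ≠ k₁ ∧
      (∀ j < i, a₀ j = 0) ∧ a₀ i = 1 ∧ a₀ ᵥ* G = Pi.single k₀ 1 ∧
      (∀ j < i, a₁ j = 0) ∧ a₁ i = 1 ∧ a₁ ᵥ* G = Pi.single k₁ 1 := by
  classical
  have hr : ∀ k : Fin ℓ, ∃ (a : Fin ℓ → ZMod 2) (i : Fin ℓ), (∀ j < i, a j = 0) ∧ a i = 1 ∧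
      a ᵥ* G = Pi.single k 1 := by
    intro k
    obtain ⟨a, ha⟩ := (vecMul_bijective_of_isUnit hG).2 (Pi.single k 1)
    have hne : (Finset.univ.filter fun j => a j ≠ 0).Nonempty := by
      by_contra h
      rw [Finset.not_nonempty_iff_eq_empty, Finset.filter_eq_empty_iff] at h
      have : a = 0 := funext fun j => by simpa using h (Finset.mem_univ j)
      have h1 := congrFun ha k
      simp [this] at h1
    refine ⟨a, Finset.min' _ hne, fun j hj => ?_, ?_, ha⟩
    · by_contra h
      exact absurd (Finset.min'_le _ j (by simpa using h)) (not_le.2 hj)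
    · have h := Finset.min'_mem _ hne
      rw [Finset.mem_filter] at h
      have h2 : ∀ z : ZMod 2, z ≠ 0 → z = 1 := by decide
      exact h2 _ h.2
  choose a lead h₁ h₂ h₃ using hr
  by_contra hcon
  -- Without a collision `lead` is injective, hence surjective: every row then has a codeword of
  -- weight `1` in its coset, all `D_i` equal `1`, and the exponent vanishes.
  have hinj : Function.Injective lead := by
    intro k₀ k₁ h
    by_contra hk
    exact hcon ⟨lead k₀, k₀, k₁, a k₀, a k₁, hk, h₁ k₀, h₂ k₀, h₃ k₀, h ▸ h₁ k₁, h ▸ h₂ k₁, h₃ k₁⟩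
  refine hE ?_
  have hD : ∀ i, Real.logb ℓ (partialDistance G i) = 0 := by
    intro i
    obtain ⟨k, rfl⟩ := (Finite.injective_iff_surjective.1 hinj) i
    have h : partialDistance G (lead k) ≤ 1 := by
      refine (partialDistance_le_hammingNorm G (h₁ k) (h₂ k)).trans ?_
      rw [h₃ k, hammingNorm, Finset.card_le_one]
      intro x hx y hy
      simp only [Finset.mem_filter, Finset.mem_univ, true_and, ne_eq, Pi.single_apply,
        ite_eq_right_iff, not_forall] at hx hy
      rw [hx.1, hy.1]
    rw [le_antisymm h (one_le_partialDistance hG _)]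
    simp
  simp [polarExponent, hD]

/-! ### One-step bounds for the Bhattacharyya parameter -/

namespace BDMC

variable (W : BDMC.{u}) {ℓ : ℕ} (G : Matrix (Fin ℓ) (Fin ℓ) (ZMod 2))

theorem combined_nonneg (y : Fin ℓ → W.Out) (u : Fin ℓ → ZMod 2) : 0 ≤ W.combined G y u :=
  Finset.prod_nonneg fun _ _ => W.prob_nonneg _ _

/-- The input vectors compatible with the prefix `p` and the bit `x` at position `i`. -/
def inputs (i : Fin ℓ) (p : {j : Fin ℓ // j < i} → ZMod 2) (x : ZMod 2) :
    Finset (Fin ℓ → ZMod 2) :=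
  Finset.univ.filter fun u => (∀ j : {j : Fin ℓ // j < i}, u j = p j) ∧ u i = x

theorem mem_inputs {i : Fin ℓ} {p : {j : Fin ℓ // j < i} → ZMod 2} {x : ZMod 2}
    {u : Fin ℓ → ZMod 2} :
    u ∈ inputs i p x ↔ (∀ j : {j : Fin ℓ // j < i}, u j = p j) ∧ u i = x := by
  simp [inputs]

theorem splitProb_eq (i : Fin ℓ) (o : (Fin ℓ → W.Out) × ({j : Fin ℓ // j < i} → ZMod 2))
    (x : ZMod 2) : W.splitProb G i o x =
      (1 / 2 ^ (ℓ - 1)) * ∑ u ∈ inputs i o.2 x, W.combined G o.1 u := rfl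

theorem sum_inputs {M : Type*} [AddCommMonoid M] (i : Fin ℓ) (x : ZMod 2)
    (f : (Fin ℓ → ZMod 2) → M) :
    ∑ p : {j : Fin ℓ // j < i} → ZMod 2, ∑ u ∈ inputs i p x, f u =
      ∑ u : Fin ℓ → ZMod 2 with u i = x, f u := by
  classical
  simp_rw [inputs, Finset.sum_filter]
  rw [Finset.sum_comm]
  refine Finset.sum_congr rfl fun u _ => ?_
  rw [Finset.sum_eq_single (fun j : {j : Fin ℓ // j < i} => u j)]
  · simp
  · intro p _ hp
    rw [if_neg]
    rintro ⟨h, _⟩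
    exact hp (funext fun j => (h j).symm)
  · simp

theorem sum_inputs_add {M : Type*} [AddCommMonoid M] {i : Fin ℓ} {a : Fin ℓ → ZMod 2}
    (ha : ∀ j < i, a j = 0) (p : {j : Fin ℓ // j < i} → ZMod 2) (x : ZMod 2)
    (f : (Fin ℓ → ZMod 2) → M) :
    ∑ u ∈ inputs i p (x + a i), f u = ∑ u ∈ inputs i p x, f (u + a) := by
  symm
  refine Finset.sum_equiv (Equiv.addRight a) (fun u => ?_) fun u _ => rfl
  simp only [mem_inputs, Equiv.coe_addRight, Pi.add_apply, add_left_inj]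
  refine and_congr_left fun _ => forall_congr' fun j => ?_
  rw [ha j j.2, add_zero]

/-- The sum factors over coordinates: a factor `Z` where the two codewords differ, and `1` where
they agree. -/
theorem sum_sqrt_combined (y u : Fin ℓ → ZMod 2) :
    ∑ z, √(W.combined G z y * W.combined G z u) =
      W.bhattacharyya ^ hammingDist (y ᵥ* G) (u ᵥ* G) := by
  classical
  have h : ∀ z, √(W.combined G z y * W.combined G z u) =
      ∏ k, √(W.prob (z k) ((y ᵥ* G) k) * W.prob (z k) ((u ᵥ* G) k)) := fun z => by
    rw [combined, combined, ← Finset.prod_mul_distrib, Real.sqrt_prod]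
    exact fun k _ => mul_nonneg (W.prob_nonneg _ _) (W.prob_nonneg _ _)
  have h2 : ∀ x x' : ZMod 2, ∑ z, √(W.prob z x * W.prob z x') =
      if x ≠ x' then W.bhattacharyya else 1 := by
    intro x x'
    split_ifs with hx
    · have : (x = 0 ∧ x' = 1) ∨ (x = 1 ∧ x' = 0) := by revert x x'; decide
      rcases this with ⟨rfl, rfl⟩ | ⟨rfl, rfl⟩
      · rfl
      · simp_rw [mul_comm (W.prob _ 1)]; rfl
    · rw [not_not] at hx
      subst hx
      simp_rw [Real.sqrt_mul_self (W.prob_nonneg _ _)]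
      exact W.sum_prob x
  simp_rw [h]
  rw [← Fintype.prod_sum fun k z => √(W.prob z ((y ᵥ* G) k) * W.prob z ((u ᵥ* G) k))]
  simp_rw [h2]
  rw [Finset.prod_ite, Finset.prod_const, Finset.prod_const_one, mul_one]
  rfl

theorem sqrt_sum_mul_sum_le {α β : Type*} (s : Finset α) (t : Finset β) (f : α → ℝ) (g : β → ℝ) :
    √((∑ a ∈ s, f a) * ∑ b ∈ t, g b) ≤ ∑ a ∈ s, ∑ b ∈ t, √(f a * g b) := by
  have hsq : ∀ x : ℝ, x ≤ √x ^ 2 := fun x => by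
    rcases le_total 0 x with h | h
    · rw [Real.sq_sqrt h]
    · exact h.trans (sq_nonneg _)
  have hadd : ∀ x y : ℝ, √(x + y) ≤ √x + √y := fun x y => by
    have hx := Real.sqrt_nonneg x
    have hy := Real.sqrt_nonneg y
    refine Real.sqrt_le_iff.2 ⟨by positivity, ?_⟩
    nlinarith [hsq x, hsq y, mul_nonneg hx hy]
  have key : ∀ (r : Finset (α × β)) (h : α × β → ℝ), √(∑ c ∈ r, h c) ≤ ∑ c ∈ r, √(h c) :=
    fun r h => Finset.le_sum_of_subadditive _ Real.sqrt_zero.le hadd r h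
  rw [Finset.sum_mul_sum, ← Finset.sum_product', ← Finset.sum_product']
  exact key _ _

theorem bhattacharyya_split_eq (i : Fin ℓ) : (W.split G i).bhattacharyya =
    ∑ y : Fin ℓ → W.Out, ∑ p : {j : Fin ℓ // j < i} → ZMod 2,
      √(W.splitProb G i (y, p) 0 * W.splitProb G i (y, p) 1) := Fintype.sum_prod_type _

/-- Subadditivity of the square root leaves pairs of inputs with the same prefix and different bit
`i`; their codewords are at distance at least `D_i`. Normalization absorbs the count of first
members. -/
theorem bhattacharyya_split_le (i : Fin ℓ) :
    (W.split G i).bhattacharyya ≤ 2 ^ ℓ * W.bhattacharyya ^ partialDistance G i := by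
  classical
  have hZ := W.bhattacharyya_nonneg
  have hZ1 := W.bhattacharyya_le_one
  have hc : (0 : ℝ) ≤ 1 / 2 ^ (ℓ - 1) := by positivity
  calc (W.split G i).bhattacharyya
      = ∑ y : Fin ℓ → W.Out, ∑ p : {j : Fin ℓ // j < i} → ZMod 2,
          √(W.splitProb G i (y, p) 0 * W.splitProb G i (y, p) 1) :=
        W.bhattacharyya_split_eq G i
    _ ≤ ∑ y : Fin ℓ → W.Out, ∑ p : {j : Fin ℓ // j < i} → ZMod 2, (1 / 2 ^ (ℓ - 1)) *
          ∑ u ∈ inputs i p 0, ∑ v ∈ inputs i p 1, √(W.combined G y u * W.combined G y v) := by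
        refine Finset.sum_le_sum fun y _ => Finset.sum_le_sum fun p _ => ?_
        rw [splitProb_eq, splitProb_eq, mul_mul_mul_comm, Real.sqrt_mul (mul_self_nonneg _),
          Real.sqrt_mul_self hc]
        exact mul_le_mul_of_nonneg_left (sqrt_sum_mul_sum_le _ _ _ _) hc
    _ = (1 / 2 ^ (ℓ - 1)) * ∑ p : {j : Fin ℓ // j < i} → ZMod 2, ∑ u ∈ inputs i p 0,
          ∑ v ∈ inputs i p 1, W.bhattacharyya ^ hammingDist (u ᵥ* G) (v ᵥ* G) := by
        simp_rw [← Finset.mul_sum, ← sum_sqrt_combined]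
        rw [Finset.sum_comm]
        congr 1
        refine Finset.sum_congr rfl fun p _ => ?_
        rw [Finset.sum_comm]
        refine Finset.sum_congr rfl fun u _ => ?_
        rw [Finset.sum_comm]
    _ ≤ (1 / 2 ^ (ℓ - 1)) * ∑ p : {j : Fin ℓ // j < i} → ZMod 2, ∑ u ∈ inputs i p 0,
          2 ^ ℓ * W.bhattacharyya ^ partialDistance G i := by
        refine mul_le_mul_of_nonneg_left (Finset.sum_le_sum fun p _ => Finset.sum_le_sum
          fun u hu => ?_) hc
        calc ∑ v ∈ inputs i p 1, W.bhattacharyya ^ hammingDist (u ᵥ* G) (v ᵥ* G)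
            ≤ ∑ v ∈ inputs i p 1, W.bhattacharyya ^ partialDistance G i := by
              refine Finset.sum_le_sum fun v hv => pow_le_pow_of_le_one hZ hZ1 ?_
              rw [mem_inputs] at hu hv
              rw [hammingDist_eq_hammingNorm, neg_add_eq_sub, ← Matrix.sub_vecMul]
              refine partialDistance_le_hammingNorm G (fun j hj => ?_) (by simp [hu.2, hv.2])
              rw [Pi.sub_apply, hu.1 ⟨j, hj⟩, hv.1 ⟨j, hj⟩, sub_self]
          -- Crude count of the second members by all `2 ^ ℓ` vectors; only a constant is needed.
          _ ≤ ∑ v : Fin ℓ → ZMod 2, W.bhattacharyya ^ partialDistance G i :=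
              Finset.sum_le_univ_sum_of_nonneg fun _ => by positivity
          _ = _ := by simp
    _ = 2 ^ ℓ * W.bhattacharyya ^ partialDistance G i := by
        rw [sum_inputs, Finset.sum_const, card_fixed, nsmul_eq_mul]
        push_cast
        field_simp

/-- Cauchy–Schwarz, pairing each input `u` with `u + a`, where `aG` has weight `D_i`. -/
theorem pow_partialDistance_le_bhattacharyya_split (i : Fin ℓ) :
    W.bhattacharyya ^ partialDistance G i ≤ (W.split G i).bhattacharyya := by
  classical
  obtain ⟨a, ha, hi, hd⟩ := exists_hammingNorm_eq_partialDistance G i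
  have hc : (0 : ℝ) ≤ 1 / 2 ^ (ℓ - 1) := by positivity
  calc W.bhattacharyya ^ partialDistance G i
      = (1 / 2 ^ (ℓ - 1)) * ∑ p : {j : Fin ℓ // j < i} → ZMod 2, ∑ u ∈ inputs i p 0,
          W.bhattacharyya ^ hammingDist (u ᵥ* G) ((u + a) ᵥ* G) := by
        have : ∀ u : Fin ℓ → ZMod 2, hammingDist (u ᵥ* G) ((u + a) ᵥ* G) =
            partialDistance G i := fun u => by
          rw [hammingDist_eq_hammingNorm, neg_add_eq_sub, ← Matrix.sub_vecMul,
            add_sub_cancel_left, hd]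
        simp_rw [this]
        rw [sum_inputs, Finset.sum_const, card_fixed, nsmul_eq_mul]
        push_cast
        field_simp
    _ = ∑ y : Fin ℓ → W.Out, ∑ p : {j : Fin ℓ // j < i} → ZMod 2, (1 / 2 ^ (ℓ - 1)) *
          ∑ u ∈ inputs i p 0, √(W.combined G y u * W.combined G y (u + a)) := by
        simp_rw [← Finset.mul_sum, ← sum_sqrt_combined]
        rw [Finset.sum_comm]
        congr 1
        refine Finset.sum_congr rfl fun p _ => ?_
        rw [Finset.sum_comm]
    _ ≤ ∑ y : Fin ℓ → W.Out, ∑ p : {j : Fin ℓ // j < i} → ZMod 2,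
          √(W.splitProb G i (y, p) 0 * W.splitProb G i (y, p) 1) := by
        refine Finset.sum_le_sum fun y _ => Finset.sum_le_sum fun p _ => ?_
        rw [splitProb_eq, splitProb_eq, mul_mul_mul_comm, Real.sqrt_mul (mul_self_nonneg _),
          Real.sqrt_mul_self hc]
        refine mul_le_mul_of_nonneg_left ?_ hc
        have h1 := sum_inputs_add ha p 0 (W.combined G y)
        rw [hi, zero_add] at h1
        rw [h1, Real.sqrt_mul (Finset.sum_nonneg fun _ _ => W.combined_nonneg G _ _)]
        simp_rw [Real.sqrt_mul (W.combined_nonneg G _ _)]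
        exact Real.sum_sqrt_mul_sqrt_le _ (fun _ => W.combined_nonneg G _ _)
          fun _ => W.combined_nonneg G _ _
    _ = (W.split G i).bhattacharyya := (W.bhattacharyya_split_eq G i).symm

/-- Bernoulli's inequality for `Z ^ D_i`, with `D_i ≤ ℓ`. -/
theorem one_sub_bhattacharyya_split_le (i : Fin ℓ) :
    1 - (W.split G i).bhattacharyya ≤ ℓ * (1 - W.bhattacharyya) := by
  have h1 := W.pow_partialDistance_le_bhattacharyya_split G i
  have h2 := one_add_mul_le_pow (a := W.bhattacharyya - 1) (by linarith [W.bhattacharyya_nonneg])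
    (partialDistance G i)
  have h3 : (partialDistance G i : ℝ) ≤ ℓ := by exact_mod_cast partialDistance_le G i
  rw [add_sub_cancel] at h2
  nlinarith [W.bhattacharyya_le_one]

end BDMC

/-! ### Sums over product alphabets -/

section ProductSums

variable {ι α : Type*} [Fintype ι] [DecidableEq ι] [Fintype α]

theorem sum_prod_mul_prod (f : α → ℝ) (g : ι → α → ℝ) :
    ∑ z : ι → α, (∏ j, f (z j)) * ∏ j, g j (z j) = ∏ j, ∑ a, f a * g j a := by
  rw [Fintype.prod_sum]
  simp_rw [Finset.prod_mul_distrib]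

theorem sum_prod_mul_apply (f : α → ℝ) (k : ι) (g : α → ℝ) :
    ∑ z : ι → α, (∏ j, f (z j)) * g (z k) =
      (∑ a, f a) ^ (Fintype.card ι - 1) * ∑ a, f a * g a := by
  have h := sum_prod_mul_prod f fun j a => if j = k then g a else 1
  simp only [Finset.prod_ite_eq', Finset.mem_univ, if_true] at h
  rw [h, ← Finset.prod_erase_mul _ _ (Finset.mem_univ k)]
  congr 1
  · rw [Finset.prod_congr rfl fun j hj => by rw [Finset.sum_congr rfl fun a _ => by
      rw [if_neg (Finset.ne_of_mem_erase hj), mul_one]], Finset.prod_const,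
      Finset.card_erase_of_mem (Finset.mem_univ k), Finset.card_univ]
  · simp

theorem sum_prod_mul_apply_mul_apply (f : α → ℝ) (hf : ∑ a, f a = 1) {k₀ k₁ : ι} (hk : k₀ ≠ k₁)
    (g h : α → ℝ) :
    ∑ z : ι → α, (∏ j, f (z j)) * (g (z k₀) * h (z k₁)) =
      (∑ a, f a * g a) * ∑ a, f a * h a := by
  have h1 := sum_prod_mul_prod f fun j a => (if j = k₀ then g a else 1) * if j = k₁ then h a else 1
  simp only [Finset.prod_mul_distrib, Finset.prod_ite_eq', Finset.mem_univ, if_true] at h1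
  rw [h1]
  have h2 : ∀ j, ∑ a, f a * ((if j = k₀ then g a else 1) * if j = k₁ then h a else 1) =
      (if j = k₀ then ∑ a, f a * g a else 1) * if j = k₁ then ∑ a, f a * h a else 1 := by
    intro j
    by_cases h0 : j = k₀
    · have : j ≠ k₁ := h0 ▸ hk
      simp [h0, hk]
    · by_cases h1 : j = k₁ <;> simp [h0, h1, hf, hk.symm]
  simp_rw [h2, Finset.prod_mul_distrib, Finset.prod_ite_eq', Finset.mem_univ, if_true]

/-- Additivity of entropy over independent coordinates, for unnormalized weights: the chain rule
uses it with total mass `2`. -/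
theorem sum_prod_mul_log_prod (f : α → ℝ) :
    ∑ z : ι → α, (∏ j, f (z j)) * Real.log (∏ j, f (z j)) =
      Fintype.card ι * ((∑ a, f a) ^ (Fintype.card ι - 1) * ∑ a, f a * Real.log (f a)) := by
  have h : ∀ z : ι → α, (∏ j, f (z j)) * Real.log (∏ j, f (z j)) =
      ∑ k, (∏ j, f (z j)) * Real.log (f (z k)) := by
    intro z
    by_cases h0 : ∏ j, f (z j) = 0
    · simp [h0]
    · rw [Real.log_prod fun j hj => Finset.prod_ne_zero_iff.1 h0 j hj, Finset.mul_sum]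
  simp_rw [h]
  rw [Finset.sum_comm]
  simp_rw [sum_prod_mul_apply f _ fun a => Real.log (f a)]
  simp

end ProductSums

/-! ### The chain rule -/

namespace BDMC

variable (W : BDMC.{u}) {ℓ : ℕ} (G : Matrix (Fin ℓ) (Fin ℓ) (ZMod 2))

/-- The sum of `W_ℓ(y | v)` over the input vectors `v` that agree with `u` on the first `m`
positions. -/
def prefixSum (m : ℕ) (y : Fin ℓ → W.Out) (u : Fin ℓ → ZMod 2) : ℝ :=
  ∑ v : Fin ℓ → ZMod 2 with ∀ j : Fin ℓ, (j : ℕ) < m → v j = u j, W.combined G y v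

/-- The unnormalized log-likelihood sum of the first `m` input bits. -/
def prefixLogSum (m : ℕ) : ℝ :=
  ∑ y, ∑ u, W.combined G y u * Real.log (W.prefixSum G m y u)

theorem sum_inputs_eq_prefixSum_succ {i : Fin ℓ} {p : {j : Fin ℓ // j < i} → ZMod 2} {x : ZMod 2}
    {u : Fin ℓ → ZMod 2} (hu : u ∈ inputs i p x) (y : Fin ℓ → W.Out) :
    ∑ v ∈ inputs i p x, W.combined G y v = W.prefixSum G (i + 1) y u := by
  rw [mem_inputs] at hu
  refine Finset.sum_congr (Finset.ext fun v => ?_) fun _ _ => rfl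
  rw [mem_inputs, Finset.mem_filter]
  constructor
  · rintro ⟨h1, h2⟩
    refine ⟨Finset.mem_univ _, fun j hj => ?_⟩
    rcases (Nat.lt_succ_iff.1 hj).lt_or_eq with h | h
    · rw [h1 ⟨j, h⟩, hu.1 ⟨j, h⟩]
    · rw [Fin.ext h, h2, hu.2]
  · rintro ⟨-, h⟩
    exact ⟨fun j => by rw [h j (Nat.lt_succ_of_lt j.2), hu.1 j],
      by rw [h i (Nat.lt_succ_self _), hu.2]⟩

theorem sum_inputs_add_sum_inputs {i : Fin ℓ} {p : {j : Fin ℓ // j < i} → ZMod 2} {x : ZMod 2}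
    {u : Fin ℓ → ZMod 2} (hu : u ∈ inputs i p x) (y : Fin ℓ → W.Out) :
    ∑ v ∈ inputs i p 0, W.combined G y v + ∑ v ∈ inputs i p 1, W.combined G y v =
      W.prefixSum G i y u := by
  classical
  rw [mem_inputs] at hu
  have h2 : ∀ z : ZMod 2, z = 0 ∨ z = 1 := by decide
  rw [← Finset.sum_union]
  · refine Finset.sum_congr (Finset.ext fun v => ?_) fun _ _ => rfl
    rw [Finset.mem_union, mem_inputs, mem_inputs, ← and_or_left, Finset.mem_filter,
      and_iff_left (h2 _), and_iff_right (Finset.mem_univ _)]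
    constructor
    · intro h j hj
      rw [h ⟨j, hj⟩, hu.1 ⟨j, hj⟩]
    · intro h j
      rw [h j j.2, hu.1 j]
  · rw [Finset.disjoint_left]
    intro v h0 h1
    rw [mem_inputs] at h0 h1
    exact absurd (h0.2.symm.trans h1.2) (by decide)

theorem sum_sum_inputs {M : Type*} [AddCommMonoid M] (i : Fin ℓ) (f : (Fin ℓ → ZMod 2) → M) :
    ∑ p : {j : Fin ℓ // j < i} → ZMod 2, ∑ x, ∑ u ∈ inputs i p x, f u = ∑ u, f u := by
  rw [Finset.sum_comm]
  simp_rw [sum_inputs]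
  exact Finset.sum_fiberwise _ _ _

/-- Up to the factor `1 / 2 ^ (ℓ - 1)`, `prefixSum` at `i + 1` is the transition probability and at
`i` its sum over both bits. The logarithms of that factor cancel in the difference. -/
theorem mutualInfo_split (i : Fin ℓ) : (W.split G i).mutualInfo =
    1 + (W.prefixLogSum G (i + 1) - W.prefixLogSum G i) / (2 ^ (ℓ - 1) * (2 * Real.log 2)) := by
  have hl := (Real.log_pos one_lt_two).ne'
  have hc : (1 / 2 ^ (ℓ - 1) : ℝ) ≠ 0 := by positivity
  set S : ((Fin ℓ → W.Out) × ({j : Fin ℓ // j < i} → ZMod 2)) → ZMod 2 → ℝ :=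
    fun o x => ∑ u ∈ inputs i o.2 x, W.combined G o.1 u with hS
  have hlog : ∀ s : ℝ, 1 / 2 ^ (ℓ - 1) * s * Real.log (1 / 2 ^ (ℓ - 1) * s) =
      1 / 2 ^ (ℓ - 1) * (s * Real.log s) + 1 / 2 ^ (ℓ - 1) * s * Real.log (1 / 2 ^ (ℓ - 1)) := by
    intro s
    rcases eq_or_ne s 0 with rfl | hs
    · simp
    · rw [Real.log_mul hc hs]; ring
  have h1 : ∑ o, ∑ x, S o x * Real.log (S o x) = W.prefixLogSum G (i + 1) := by
    rw [Fintype.sum_prod_type]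
    refine Finset.sum_congr rfl fun y _ => ?_
    rw [← sum_sum_inputs i]
    refine Finset.sum_congr rfl fun p _ => Finset.sum_congr rfl fun x _ => ?_
    rw [hS, Finset.sum_mul]
    exact Finset.sum_congr rfl fun u hu => by rw [← W.sum_inputs_eq_prefixSum_succ G hu y]
  have h2 : ∑ o, (S o 0 + S o 1) * Real.log (S o 0 + S o 1) = W.prefixLogSum G i := by
    rw [Fintype.sum_prod_type]
    refine Finset.sum_congr rfl fun y _ => ?_
    rw [← sum_sum_inputs i]
    refine Finset.sum_congr rfl fun p _ => ?_
    rw [sum_zmod_two, add_mul]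
    simp only [hS]
    rw [Finset.sum_mul, Finset.sum_mul]
    congr 1 <;> exact Finset.sum_congr rfl fun u hu => by rw [← W.sum_inputs_add_sum_inputs G hu y]
  have h3 : (∑ o, ∑ x, W.splitProb G i o x * Real.log (W.splitProb G i o x)) -
      ∑ o, (W.splitProb G i o 0 + W.splitProb G i o 1) *
        Real.log (W.splitProb G i o 0 + W.splitProb G i o 1) =
      1 / 2 ^ (ℓ - 1) * (W.prefixLogSum G (i + 1) - W.prefixLogSum G i) := by
    rw [← h1, ← h2, ← Finset.sum_sub_distrib, ← Finset.sum_sub_distrib, Finset.mul_sum]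
    refine Finset.sum_congr rfl fun o _ => ?_
    rw [sum_zmod_two, sum_zmod_two, splitProb_eq, splitProb_eq, ← mul_add, hlog, hlog, hlog]
    ring
  rw [mutualInfo_eq_sum_log]
  refine congrArg (1 + ·) ?_
  refine (congrArg (· / (2 * Real.log 2)) h3).trans ?_
  field_simp

theorem sum_combined_input {G : Matrix (Fin ℓ) (Fin ℓ) (ZMod 2)} (hG : IsUnit G)
    (y : Fin ℓ → W.Out) :
    ∑ u, W.combined G y u = ∏ k, (W.prob (y k) 0 + W.prob (y k) 1) := by
  refine ((vecMul_bijective_of_isUnit hG).sum_comp fun x : Fin ℓ → ZMod 2 =>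
    ∏ k, W.prob (y k) (x k)).trans ?_
  rw [← Fintype.prod_sum fun k x => W.prob (y k) x]
  simp_rw [sum_zmod_two]

/-- The chain rule for mutual information. -/
theorem sum_mutualInfo_split {G : Matrix (Fin ℓ) (Fin ℓ) (ZMod 2)} (hG : IsUnit G) :
    ∑ i, (W.split G i).mutualInfo = ℓ * W.mutualInfo := by
  have hl := (Real.log_pos one_lt_two).ne'
  have hfull : W.prefixLogSum G ℓ =
      ℓ * (2 ^ (ℓ - 1) * ∑ y, ∑ x, W.prob y x * Real.log (W.prob y x)) := by
    have h1 : ∀ y u, W.prefixSum G ℓ y u = W.combined G y u := fun y u => by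
      rw [prefixSum, Finset.sum_eq_single u]
      · intro v hv hne
        exact absurd (funext fun j => (Finset.mem_filter.1 hv).2 j j.2) hne
      · simp
    -- The letters are pairs of an output and an input; invertibility of `G` lets the codeword
    -- replace `u` as summation variable.
    have h2 := sum_prod_mul_log_prod (ι := Fin ℓ) fun a : W.Out × ZMod 2 => W.prob a.1 a.2
    rw [Fintype.sum_prod_type, Fintype.sum_prod_type, Fintype.card_fin] at h2
    have h3 : ∑ y, ∑ x, W.prob y x = 2 := by
      rw [Finset.sum_comm]; simp [W.sum_prob]
    rw [h3] at h2
    rw [← h2, ← (Equiv.arrowProdEquivProdArrow (Fin ℓ) (fun _ => W.Out)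
      (fun _ => ZMod 2)).symm.sum_comp,    Fintype.sum_prod_type]
    refine Finset.sum_congr rfl fun y _ => ?_
    simp_rw [h1]
    exact (vecMul_bijective_of_isUnit hG).sum_comp fun x : Fin ℓ → ZMod 2 =>
      (∏ k, W.prob (y k) (x k)) * Real.log (∏ k, W.prob (y k) (x k))
  have hempty : W.prefixLogSum G 0 =
      ℓ * (2 ^ (ℓ - 1) * ∑ y, (W.prob y 0 + W.prob y 1) *
        Real.log (W.prob y 0 + W.prob y 1)) := by
    have h1 : ∀ y u, W.prefixSum G 0 y u = ∏ k, (W.prob (y k) 0 + W.prob (y k) 1) := fun y u => by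
      rw [← W.sum_combined_input hG, prefixSum]
      simp
    have h2 := sum_prod_mul_log_prod (ι := Fin ℓ) fun y => W.prob y 0 + W.prob y 1
    have h3 : ∑ y, (W.prob y 0 + W.prob y 1) = 2 := by
      rw [Finset.sum_add_distrib, W.sum_prob, W.sum_prob]; norm_num
    rw [h3, Fintype.card_fin] at h2
    rw [← h2]
    refine Finset.sum_congr rfl fun y _ => ?_
    simp_rw [h1]
    rw [← Finset.sum_mul, W.sum_combined_input hG]
  have htel : ∑ i : Fin ℓ, (W.prefixLogSum G (i + 1) - W.prefixLogSum G i) =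
      W.prefixLogSum G ℓ - W.prefixLogSum G 0 := by
    rw [Fin.sum_univ_eq_sum_range fun m => W.prefixLogSum G (m + 1) - W.prefixLogSum G m]
    exact Finset.sum_range_sub _ _
  simp_rw [mutualInfo_split]
  rw [Finset.sum_add_distrib, ← Finset.sum_div, htel, hfull, hempty, mutualInfo_eq_sum_log]
  simp only [Finset.sum_const, Finset.card_univ, Fintype.card_fin, nsmul_eq_mul, mul_one]
  field_simp

end BDMC

/-! ### Two unit vectors in one coset: the product bound -/

/-- The sign `(-1)^x` of a bit. -/
def bitSign (x : ZMod 2) : ℝ := if x = 0 then 1 else -1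

theorem bitSign_add (x y : ZMod 2) : bitSign (x + y) = bitSign x * bitSign y := by
  have h : ∀ z : ZMod 2, z = 0 ∨ z = 1 := by decide
  have h2 : (1 : ZMod 2) + 1 = 0 := by decide
  rcases h x with rfl | rfl <;> rcases h y with rfl | rfl <;> simp [bitSign, h2]

theorem abs_bitSign (x : ZMod 2) : |bitSign x| = 1 := by
  unfold bitSign; split_ifs <;> simp

theorem bitSign_one : bitSign 1 = -1 := by simp [bitSign]

theorem bitSign_zero : bitSign 0 = 1 := by simp [bitSign]

namespace BDMC

variable (W : BDMC.{u}) {ℓ : ℕ} (G : Matrix (Fin ℓ) (Fin ℓ) (ZMod 2))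

theorem prob_eq_bitSign (y : W.Out) (x : ZMod 2) :
    W.prob y x = W.outProb y * (1 + bitSign x * W.bias y) := by
  have h : ∀ z : ZMod 2, z = 0 ∨ z = 1 := by decide
  rcases h x with rfl | rfl
  · rw [bitSign_zero, one_mul, prob_zero_eq]
  · rw [bitSign_one, prob_one_eq]; ring

/-- The input vectors with prefix `p`. -/
def prefixInputs (i : Fin ℓ) (p : {j : Fin ℓ // j < i} → ZMod 2) : Finset (Fin ℓ → ZMod 2) :=
  Finset.univ.filter fun u => ∀ j : {j : Fin ℓ // j < i}, u j = p j

theorem sum_prefixInputs_add {i : Fin ℓ} {a : Fin ℓ → ZMod 2} (ha : ∀ j < i, a j = 0)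
    (p : {j : Fin ℓ // j < i} → ZMod 2) (f : (Fin ℓ → ZMod 2) → ℝ) :
    ∑ u ∈ prefixInputs i p, f (u + a) = ∑ u ∈ prefixInputs i p, f u := by
  refine Finset.sum_equiv (Equiv.addRight a) (fun u => ?_) fun u _ => rfl
  simp only [prefixInputs, Finset.mem_filter, Finset.mem_univ, true_and, Equiv.coe_addRight,
    Pi.add_apply]
  refine forall_congr' fun j => ?_
  rw [ha j j.2, add_zero]

/-- Translation by `a` permutes the vectors with prefix `p`, so the sum equals its own negative. -/
theorem sum_prefixInputs_eq_zero {i : Fin ℓ} {a : Fin ℓ → ZMod 2} (ha : ∀ j < i, a j = 0)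
    (p : {j : Fin ℓ // j < i} → ZMod 2) {f : (Fin ℓ → ZMod 2) → ℝ} (hf : ∀ u, f (u + a) = -f u) :
    ∑ u ∈ prefixInputs i p, f u = 0 := by
  have h := sum_prefixInputs_add ha p f
  simp_rw [hf, Finset.sum_neg_distrib] at h
  linarith

theorem sum_prefixInputs_mul_bitSign {i : Fin ℓ} (p : {j : Fin ℓ // j < i} → ZMod 2)
    (f : (Fin ℓ → ZMod 2) → ℝ) (s : ZMod 2 → ℝ) :
    ∑ u ∈ prefixInputs i p, s (u i) * f u =
      s 0 * ∑ u ∈ inputs i p 0, f u + s 1 * ∑ u ∈ inputs i p 1, f u := by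
  rw [← Finset.sum_fiberwise (prefixInputs i p) (fun u => u i), sum_zmod_two, Finset.mul_sum,
    Finset.mul_sum]
  congr 1 <;>
  · rw [prefixInputs, Finset.filter_filter]
    refine Finset.sum_congr rfl fun u hu => ?_
    rw [(mem_inputs.1 hu).2]

section TwoUnitVectors

variable {G} {i k₀ k₁ : Fin ℓ} {a₀ a₁ : Fin ℓ → ZMod 2}

/-- Expand the likelihood as `Q * (1 + e₀ t₀) * (1 + e₁ t₁)`, where `Q` ignores the code bits at
`k₀` and `k₁`. Shifting by `a₀` flips `e` and `e₀` only, shifting by `a₁` flips `e` and `e₁` only.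
Hence only the term `t₀ t₁ e e₀ e₁ Q` survives in the difference over bit `i`, and only `Q` in the
total. -/
theorem abs_sum_inputs_sub_le (hk : k₀ ≠ k₁)
    (h₀ : ∀ j < i, a₀ j = 0) (hi₀ : a₀ i = 1) (hu₀ : a₀ ᵥ* G = Pi.single k₀ 1)
    (h₁ : ∀ j < i, a₁ j = 0) (hi₁ : a₁ i = 1) (hu₁ : a₁ ᵥ* G = Pi.single k₁ 1)
    (y : Fin ℓ → W.Out) (p : {j : Fin ℓ // j < i} → ZMod 2) :
    |∑ u ∈ inputs i p 0, W.combined G y u - ∑ u ∈ inputs i p 1, W.combined G y u| ≤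
      |W.bias (y k₀) * W.bias (y k₁)| *
        (∑ u ∈ inputs i p 0, W.combined G y u + ∑ u ∈ inputs i p 1, W.combined G y u) := by
  classical
  set t₀ := W.bias (y k₀)
  set t₁ := W.bias (y k₁)
  set Q : (Fin ℓ → ZMod 2) → ℝ := fun u => W.outProb (y k₀) * W.outProb (y k₁) *
    ∏ k ∈ (Finset.univ.erase k₀).erase k₁, W.prob (y k) ((u ᵥ* G) k) with hQ
  set e₀ : (Fin ℓ → ZMod 2) → ℝ := fun u => bitSign ((u ᵥ* G) k₀) with he₀
  set e₁ : (Fin ℓ → ZMod 2) → ℝ := fun u => bitSign ((u ᵥ* G) k₁) with he₁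
  set e : (Fin ℓ → ZMod 2) → ℝ := fun u => bitSign (u i) with he
  have hQ_nonneg : ∀ u, 0 ≤ Q u := fun u => mul_nonneg
    (mul_nonneg (W.outProb_nonneg _) (W.outProb_nonneg _))
    (Finset.prod_nonneg fun _ _ => W.prob_nonneg _ _)
  have hcomb : ∀ u, W.combined G y u = Q u * ((1 + e₀ u * t₀) * (1 + e₁ u * t₁)) := by
    intro u
    rw [combined, ← Finset.mul_prod_erase _ _ (Finset.mem_univ k₀),
      ← Finset.mul_prod_erase (Finset.univ.erase k₀) _
        (Finset.mem_erase.2 ⟨hk.symm, Finset.mem_univ k₁⟩), W.prob_eq_bitSign (y k₀),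
      W.prob_eq_bitSign (y k₁)]
    simp only [hQ, he₀, he₁]
    ring
  have hQ₀ : ∀ u, Q (u + a₀) = Q u := by
    intro u
    simp only [hQ]
    congr 1
    refine Finset.prod_congr rfl fun k hk' => ?_
    rw [Matrix.add_vecMul, hu₀, Pi.add_apply, Pi.single_eq_of_ne, add_zero]
    exact Finset.ne_of_mem_erase (Finset.mem_of_mem_erase hk')
  have hQ₁ : ∀ u, Q (u + a₁) = Q u := by
    intro u
    simp only [hQ]
    congr 1
    refine Finset.prod_congr rfl fun k hk' => ?_
    rw [Matrix.add_vecMul, hu₁, Pi.add_apply, Pi.single_eq_of_ne, add_zero]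
    exact Finset.ne_of_mem_erase hk'
  have he₀₀ : ∀ u, e₀ (u + a₀) = -e₀ u := fun u => by
    simp [he₀, Matrix.add_vecMul, hu₀, bitSign_add, bitSign_one]
  have he₁₁ : ∀ u, e₁ (u + a₁) = -e₁ u := fun u => by
    simp [he₁, Matrix.add_vecMul, hu₁, bitSign_add, bitSign_one]
  have he₀₁ : ∀ u, e₀ (u + a₁) = e₀ u := fun u => by
    simp [he₀, Matrix.add_vecMul, hu₁, Pi.single_eq_of_ne hk]
  have he₁₀ : ∀ u, e₁ (u + a₀) = e₁ u := fun u => by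
    simp [he₁, Matrix.add_vecMul, hu₀, Pi.single_eq_of_ne hk.symm]
  have hei₀ : ∀ u, e (u + a₀) = -e u := fun u => by
    simp [he, hi₀, bitSign_add, bitSign_one]
  have hei₁ : ∀ u, e (u + a₁) = -e u := fun u => by
    simp [he, hi₁, bitSign_add, bitSign_one]
  have hsub : ∑ u ∈ inputs i p 0, W.combined G y u - ∑ u ∈ inputs i p 1, W.combined G y u =
      t₀ * t₁ * ∑ u ∈ prefixInputs i p, e u * e₀ u * e₁ u * Q u := by
    have h := sum_prefixInputs_mul_bitSign p (W.combined G y) bitSign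
    rw [bitSign_zero, bitSign_one] at h
    have z₁ := sum_prefixInputs_eq_zero h₀ p (f := fun u => e u * Q u) fun u => by
      simp only [hei₀, hQ₀]; ring
    have z₂ := sum_prefixInputs_eq_zero h₁ p (f := fun u => e u * e₀ u * Q u) fun u => by
      simp only [hei₁, he₀₁, hQ₁]; ring
    have z₃ := sum_prefixInputs_eq_zero h₀ p (f := fun u => e u * e₁ u * Q u) fun u => by
      simp only [hei₀, he₁₀, hQ₀]; ring
    have hexp : ∑ u ∈ prefixInputs i p, bitSign (u i) * W.combined G y u =
        ∑ u ∈ prefixInputs i p, (e u * Q u + t₀ * (e u * e₀ u * Q u) + t₁ * (e u * e₁ u * Q u) +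
          t₀ * t₁ * (e u * e₀ u * e₁ u * Q u)) :=
      Finset.sum_congr rfl fun u _ => by rw [hcomb]; simp only [he]; ring
    simp only [Finset.sum_add_distrib, ← Finset.mul_sum, z₁, z₂, z₃] at hexp
    linarith
  have hadd : ∑ u ∈ inputs i p 0, W.combined G y u + ∑ u ∈ inputs i p 1, W.combined G y u =
      ∑ u ∈ prefixInputs i p, Q u := by
    have h := sum_prefixInputs_mul_bitSign p (W.combined G y) fun _ => 1
    simp only [one_mul] at h
    have z₁ := sum_prefixInputs_eq_zero h₀ p (f := fun u => e₀ u * Q u) fun u => by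
      simp only [he₀₀, hQ₀]; ring
    have z₂ := sum_prefixInputs_eq_zero h₁ p (f := fun u => e₁ u * Q u) fun u => by
      simp only [he₁₁, hQ₁]; ring
    have z₃ := sum_prefixInputs_eq_zero h₀ p (f := fun u => e₀ u * e₁ u * Q u) fun u => by
      simp only [he₀₀, he₁₀, hQ₀]; ring
    have hexp : ∑ u ∈ prefixInputs i p, W.combined G y u =
        ∑ u ∈ prefixInputs i p, (Q u + t₀ * (e₀ u * Q u) + t₁ * (e₁ u * Q u) +
          t₀ * t₁ * (e₀ u * e₁ u * Q u)) :=
      Finset.sum_congr rfl fun u _ => by rw [hcomb]; ring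
    simp only [Finset.sum_add_distrib, ← Finset.mul_sum, z₁, z₂, z₃] at hexp
    linarith
  rw [hsub, hadd, abs_mul]
  refine mul_le_mul_of_nonneg_left ?_ (abs_nonneg _)
  refine (Finset.abs_sum_le_sum_abs _ _).trans (Finset.sum_le_sum fun u _ => ?_)
  rw [abs_mul, abs_mul, abs_mul, abs_of_nonneg (hQ_nonneg u)]
  simp only [he, he₀, he₁, abs_bitSign, one_mul, le_refl]

theorem abs_bias_split_le (hk : k₀ ≠ k₁)
    (h₀ : ∀ j < i, a₀ j = 0) (hi₀ : a₀ i = 1) (hu₀ : a₀ ᵥ* G = Pi.single k₀ 1)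
    (h₁ : ∀ j < i, a₁ j = 0) (hi₁ : a₁ i = 1) (hu₁ : a₁ ᵥ* G = Pi.single k₁ 1)
    (y : Fin ℓ → W.Out) (p : {j : Fin ℓ // j < i} → ZMod 2) :
    |(W.split G i).bias (y, p)| ≤ |W.bias (y k₀) * W.bias (y k₁)| := by
  have hc : (0 : ℝ) < 1 / 2 ^ (ℓ - 1) := by positivity
  change |(W.splitProb G i (y, p) 0 - W.splitProb G i (y, p) 1) /
    (W.splitProb G i (y, p) 0 + W.splitProb G i (y, p) 1)| ≤ _
  rw [splitProb_eq, splitProb_eq, ← mul_sub, ← mul_add, mul_div_mul_left _ _ hc.ne', abs_div]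
  refine div_le_of_le_mul₀ (abs_nonneg _) (abs_nonneg _) ?_
  refine (W.abs_sum_inputs_sub_le hk h₀ hi₀ hu₀ h₁ hi₁ hu₁ y p).trans ?_
  exact mul_le_mul_of_nonneg_left (le_abs_self _) (abs_nonneg _)

variable (i) in
-- For invertible `G` uniform inputs give uniform codewords, so the outputs are independent once the
-- prefix is summed out.
theorem sum_outProb_split (hG : IsUnit G) (y : Fin ℓ → W.Out) :
    ∑ p : {j : Fin ℓ // j < i} → ZMod 2, (W.split G i).outProb (y, p) =
      ∏ k, W.outProb (y k) := by
  have h : ∀ p : {j : Fin ℓ // j < i} → ZMod 2, (W.split G i).outProb (y, p) =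
      1 / 2 ^ (ℓ - 1) / 2 * ∑ x, ∑ u ∈ inputs i p x, W.combined G y u := fun p => by
    change (W.splitProb G i (y, p) 0 + W.splitProb G i (y, p) 1) / 2 = _
    rw [splitProb_eq, splitProb_eq, sum_zmod_two]
    ring
  simp_rw [h]
  have hℓ : ℓ - 1 + 1 = ℓ := Nat.sub_add_cancel i.pos
  rw [← Finset.mul_sum, sum_sum_inputs, W.sum_combined_input hG]
  simp_rw [prob_zero_add_prob_one]
  rw [Finset.prod_mul_distrib, Finset.prod_const, Finset.card_univ, Fintype.card_fin, ← mul_assoc,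
    div_div, ← pow_succ, hℓ, one_div, inv_mul_cancel₀ (by positivity), one_mul]

variable (i) in
theorem sum_outProb_split_mul_le (hG : IsUnit G) (f : ℝ → ℝ) (g : (Fin ℓ → W.Out) → ℝ)
    (hfg : ∀ y p, f ((W.split G i).bias (y, p)) ≤ g y) :
    ∑ o, (W.split G i).outProb o * f ((W.split G i).bias o) ≤
      ∑ y : Fin ℓ → W.Out, (∏ k, W.outProb (y k)) * g y := by
  calc ∑ o, (W.split G i).outProb o * f ((W.split G i).bias o)
      = ∑ y : Fin ℓ → W.Out, ∑ p : {j : Fin ℓ // j < i} → ZMod 2,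
          (W.split G i).outProb (y, p) * f ((W.split G i).bias (y, p)) := Fintype.sum_prod_type _
    _ ≤ ∑ y : Fin ℓ → W.Out, ∑ p : {j : Fin ℓ // j < i} → ZMod 2,
          (W.split G i).outProb (y, p) * g y :=
        Finset.sum_le_sum fun y _ => Finset.sum_le_sum fun p _ =>
          mul_le_mul_of_nonneg_left (hfg y p) ((W.split G i).outProb_nonneg _)
    _ = _ := by
        refine Finset.sum_congr rfl fun y _ => ?_
        rw [← Finset.sum_mul, W.sum_outProb_split i hG]

/-- The capacity at `t₀ t₁` is at most `|t₀|` times that at `t₁`, and the outputs at `k₀ ≠ k₁` are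
independent. -/
theorem mutualInfo_split_le (hG : IsUnit G) (hk : k₀ ≠ k₁)
    (h₀ : ∀ j < i, a₀ j = 0) (hi₀ : a₀ i = 1) (hu₀ : a₀ ᵥ* G = Pi.single k₀ 1)
    (h₁ : ∀ j < i, a₁ j = 0) (hi₁ : a₁ i = 1) (hu₁ : a₁ ᵥ* G = Pi.single k₁ 1) :
    (W.split G i).mutualInfo ≤ W.totalVariation * W.mutualInfo := by
  rw [mutualInfo_eq_sum_bscCapacity, mutualInfo_eq_sum_bscCapacity, totalVariation,
    ← sum_prod_mul_apply_mul_apply _ W.sum_outProb hk]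
  refine W.sum_outProb_split_mul_le i hG bscCapacity
    (fun y => |W.bias (y k₀)| * bscCapacity (W.bias (y k₁))) fun y p => ?_
  have hle : |W.bias (y k₀) * W.bias (y k₁)| ≤ 1 := by
    rw [abs_mul]
    exact mul_le_one₀ (W.abs_bias_le_one _) (abs_nonneg _) (W.abs_bias_le_one _)
  exact (bscCapacity_mono (W.abs_bias_split_le hk h₀ hi₀ hu₀ h₁ hi₁ hu₁ y p) hle).trans
    (bscCapacity_mul_le (W.abs_bias_le_one _) (W.abs_bias_le_one _))

/-- The mean squared bias of the bit channel is at most the square of that of `W`, which is at most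
`2 * (1 - Z)`; hence the constant `4`. -/
theorem one_sub_bhattacharyya_split_le_sq (hG : IsUnit G) (hk : k₀ ≠ k₁)
    (h₀ : ∀ j < i, a₀ j = 0) (hi₀ : a₀ i = 1) (hu₀ : a₀ ᵥ* G = Pi.single k₀ 1)
    (h₁ : ∀ j < i, a₁ j = 0) (hi₁ : a₁ i = 1) (hu₁ : a₁ ᵥ* G = Pi.single k₁ 1) :
    1 - (W.split G i).bhattacharyya ≤ 4 * (1 - W.bhattacharyya) ^ 2 := by
  have h := W.sum_outProb_split_mul_le i hG (fun t => 1 - √(1 - t ^ 2))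
    (fun y => W.bias (y k₀) ^ 2 * W.bias (y k₁) ^ 2) fun y p => by
      refine (one_sub_sqrt_le_sq ((W.split G i).bias_sq_le_one _)).trans ?_
      rw [← mul_pow, ← sq_abs, ← sq_abs (W.bias (y k₀) * _)]
      exact pow_le_pow_left₀ (abs_nonneg _)
        (W.abs_bias_split_le hk h₀ hi₀ hu₀ h₁ hi₁ hu₁ y p) 2
  rw [sum_prod_mul_apply_mul_apply _ W.sum_outProb hk (fun y => W.bias y ^ 2)
    fun y => W.bias y ^ 2] at h
  rw [one_sub_bhattacharyya_eq]
  refine h.trans ?_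
  have h2 := W.sum_outProb_mul_bias_sq_le
  have h3 : 0 ≤ ∑ y, W.outProb y * W.bias y ^ 2 :=
    Finset.sum_nonneg fun y _ => mul_nonneg (W.outProb_nonneg y) (sq_nonneg _)
  nlinarith

end TwoUnitVectors

end BDMC

/-! ### Deterministic recursions -/

theorem eventually_mul_add_le {S : ℕ → ℝ} {E β : ℝ}
    (hS : Tendsto (fun n => S n / n) atTop (𝓝 E)) (hβ : E < β) (L : ℝ) :
    ∀ᶠ n : ℕ in atTop, L + S n ≤ n * β := by
  have h : Tendsto (fun n : ℕ => L / n + S n / n) atTop (𝓝 (0 + E)) :=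
    (tendsto_const_div_atTop_nhds_zero_nat L).add hS
  rw [zero_add] at h
  filter_upwards [h.eventually_lt_const hβ, eventually_gt_atTop 0] with n hn hpos
  have hn' : (0 : ℝ) < n := by exact_mod_cast hpos
  rw [← add_div, div_lt_iff₀ hn'] at hn
  linarith

/-- With `x = -log₂ X` the recursion reads `x (n + 1) ≥ d n * x n - c`. Once `x n ≥ K` the loss `c`
costs at most a factor `ρ = r ^ (-ε)`, that is, `ε` per step in the exponent of `r`. -/
theorem eventually_le_two_rpow_of_le_mul_pow {X : ℕ → ℝ} {d : ℕ → ℕ} {C r E β : ℝ}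
    (hr : 1 < r) (hC : 1 ≤ C) (hd : ∀ n, 1 ≤ d n) (hX₀ : ∀ n, 0 ≤ X n)
    (hX : ∀ n, X (n + 1) ≤ C * X n ^ d n) (hlim : Tendsto X atTop (𝓝 0))
    (hS : Tendsto (fun n : ℕ => (∑ k ∈ Finset.range n, Real.logb r (d k)) / n) atTop (𝓝 E))
    (hβ : β < E) :
    ∀ᶠ n : ℕ in atTop, X n ≤ (2 : ℝ) ^ (-(r ^ ((n : ℝ) * β))) := by
  have hr₀ : 0 < r := by linarith
  obtain ⟨ε, hε, hεE⟩ : ∃ ε : ℝ, 0 < ε ∧ β + ε < E := ⟨(E - β) / 2, by linarith, by linarith⟩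
  set ρ : ℝ := r ^ (-ε) with hρ
  have hρ₀ : 0 < ρ := Real.rpow_pos_of_pos hr₀ _
  have hρ₁ : ρ < 1 := Real.rpow_lt_one_of_one_lt_of_neg hr (by linarith)
  set c : ℝ := Real.logb 2 C with hc
  have hc₀ : 0 ≤ c := Real.logb_nonneg one_lt_two hC
  have hCc : C = (2 : ℝ) ^ c := (Real.rpow_logb two_pos (by norm_num) (by linarith)).symm
  -- Large enough that `c ≤ (1 - ρ) * K`; the `+ 1` keeps `K` positive when `c = 0`.
  set K : ℝ := c / (1 - ρ) + 1 with hK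
  have hρ' : 0 < 1 - ρ := by linarith
  have hK₀ : 0 < K := by positivity
  have hKc : c ≤ (1 - ρ) * K := by
    rw [hK, mul_add, mul_div_cancel₀ _ hρ'.ne']; linarith
  obtain ⟨m, hm⟩ := eventually_atTop.1 (hlim.eventually_le_const
    (show (0 : ℝ) < 2 ^ (-K) from Real.rpow_pos_of_pos two_pos _))
  set S : ℕ → ℝ := fun n => ∑ k ∈ Finset.range n, Real.logb r (d k) with hSdef
  set L : ℝ := Real.logb r K - S m + m * ε with hL
  have key : ∀ n, m ≤ n → X n ≤ (2 : ℝ) ^ (-(r ^ (L + S n - n * ε))) := by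
    intro n hn
    induction n, hn using Nat.le_induction with
    | base =>
      have : L + S m - m * ε = Real.logb r K := by rw [hL]; ring
      rw [this, Real.rpow_logb hr₀ hr.ne' hK₀]
      exact hm m le_rfl
    | succ n hn ih =>
      set a : ℝ := r ^ (L + S n - n * ε) with ha
      have hd₁ : (1 : ℝ) ≤ d n := by exact_mod_cast hd n
      have hstep : r ^ (L + S (n + 1) - (n + 1 : ℕ) * ε) = ρ * d n * a := by
        have h1 : L + S (n + 1) - (n + 1 : ℕ) * ε =
            -ε + Real.logb r (d n) + (L + S n - n * ε) := by
          simp only [hSdef, Finset.sum_range_succ]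
          push_cast
          ring
        rw [h1, Real.rpow_add hr₀, Real.rpow_add hr₀,
          Real.rpow_logb hr₀ hr.ne' (by linarith)]
      -- The inductive exponent `a` may drop below `K`, as it shrinks when `d n = 1`; convergence to
      -- `0` restores the bound by `K` at every step.
      have hmax : X n ≤ (2 : ℝ) ^ (-(max a K)) := by
        rcases max_choice a K with h | h <;> rw [h]
        · exact ih
        · exact hm n hn
      have hKmax : K ≤ max a K := le_max_right _ _
      have hexp : c - max a K * d n ≤ -(ρ * d n * a) := by
        have h1 : (1 - ρ) * K ≤ (1 - ρ) * (d n * max a K) :=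
          mul_le_mul_of_nonneg_left (by nlinarith) hρ'.le
        have h2 : ρ * d n * a ≤ ρ * d n * max a K :=
          mul_le_mul_of_nonneg_left (le_max_left _ _) (by positivity)
        nlinarith
      calc X (n + 1) ≤ C * X n ^ d n := hX n
        _ ≤ (2 : ℝ) ^ c * ((2 : ℝ) ^ (-(max a K))) ^ d n := by
            rw [← hCc]
            exact mul_le_mul_of_nonneg_left (pow_le_pow_left₀ (hX₀ n) hmax _) (by linarith)
        _ = (2 : ℝ) ^ (c - max a K * d n) := by
            rw [← Real.rpow_mul_natCast two_pos.le, ← Real.rpow_add two_pos]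
            congr 1; ring
        _ ≤ _ := by
            rw [hstep]
            exact Real.rpow_le_rpow_of_exponent_le one_le_two hexp
  have hS' : Tendsto (fun n : ℕ => (-S n) / n) atTop (𝓝 (-E)) := by
    simpa only [neg_div] using hS.neg
  filter_upwards [eventually_mul_add_le hS' (β := -(β + ε)) (by linarith) (-L),
    eventually_ge_atTop m] with n hn hmn
  refine (key n hmn).trans (Real.rpow_le_rpow_of_exponent_le one_le_two (neg_le_neg ?_))
  exact Real.rpow_le_rpow_of_exponent_le hr.le (by linarith)

theorem eventually_two_rpow_le_of_pow_le {Z : ℕ → ℝ} {d : ℕ → ℕ} {r E β : ℝ} (hr : 1 < r)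
    (hd : ∀ n, 1 ≤ d n) (hZ₀ : 0 < Z 0) (hZ : ∀ n, Z n ^ d n ≤ Z (n + 1))
    (hS : Tendsto (fun n : ℕ => (∑ k ∈ Finset.range n, Real.logb r (d k)) / n) atTop (𝓝 E))
    (hβ : E < β) :
    ∀ᶠ n : ℕ in atTop, (2 : ℝ) ^ (-(r ^ ((n : ℝ) * β))) ≤ Z n := by
  have hr₀ : 0 < r := by linarith
  -- The maximum with `1` makes `a` positive, so that it is a power of `r` even if `Z 0 = 1`.
  set a : ℝ := max (-Real.logb 2 (Z 0)) 1 with ha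
  have ha₀ : 0 < a := lt_of_lt_of_le one_pos (le_max_right _ _)
  set S : ℕ → ℝ := fun n => ∑ k ∈ Finset.range n, Real.logb r (d k) with hSdef
  have key : ∀ n, (2 : ℝ) ^ (-(r ^ (Real.logb r a + S n))) ≤ Z n := by
    intro n
    induction n with
    | zero =>
      simp only [hSdef, Finset.range_zero, Finset.sum_empty, add_zero]
      rw [Real.rpow_logb hr₀ hr.ne' ha₀]
      calc (2 : ℝ) ^ (-a) ≤ 2 ^ Real.logb 2 (Z 0) :=
            Real.rpow_le_rpow_of_exponent_le one_le_two (by linarith [le_max_left (-Real.logb 2 (Z 0)) 1])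
        _ = Z 0 := Real.rpow_logb two_pos (by norm_num) hZ₀
    | succ n ih =>
      refine le_trans ?_ ((pow_le_pow_left₀ (Real.rpow_nonneg two_pos.le _) ih (d n)).trans (hZ n))
      have hd₀ : (0 : ℝ) < d n := by exact_mod_cast hd n
      rw [← Real.rpow_mul_natCast two_pos.le]
      simp only [hSdef, Finset.sum_range_succ]
      rw [← add_assoc, Real.rpow_add hr₀ _ (Real.logb r (d n)), Real.rpow_logb hr₀ hr.ne' hd₀,
        neg_mul]
  filter_upwards [eventually_mul_add_le hS hβ (Real.logb r a)] with n hn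
  exact (Real.rpow_le_rpow_of_exponent_le one_le_two
    (neg_le_neg (Real.rpow_le_rpow_of_exponent_le hr.le hn))).trans (key n)

/-- For `β < 0` the threshold is about `1 - r ^ (n β) * log 2`, a gap that closes only
exponentially, while `V` is doubly exponentially small. -/
theorem eventually_lt_one_sub_of_le_two_rpow {V : ℕ → ℝ} {r γ : ℝ} (hr : 1 < r) (hγ : 0 < γ)
    (hV : ∀ᶠ n : ℕ in atTop, V n ≤ (2 : ℝ) ^ (-(r ^ ((n : ℝ) * γ)))) (β : ℝ) :
    ∀ᶠ n : ℕ in atTop, (2 : ℝ) ^ (-(r ^ ((n : ℝ) * β))) < 1 - V n := by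
  have hr₀ : 0 < r := by linarith
  -- Lowering `β` raises the threshold, and `β' ≤ 0` puts `x` in `(0, 1]`, where Bernoulli gives `2
  -- ^ (-x) ≤ 1 - x / 2`.
  set β' : ℝ := min β 0 with hβ'
  have hq : 1 < r ^ γ := Real.one_lt_rpow hr hγ
  have h0 := tendsto_pow_const_div_const_pow_of_one_lt 0 hq
  have h1 := tendsto_pow_const_div_const_pow_of_one_lt 1 hq
  have h2 := (h0.add (h1.const_mul (-β' * Real.logb 2 r)))
  rw [mul_zero, add_zero] at h2
  filter_upwards [hV, h2.eventually_lt_const one_pos] with n hn hlt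
  set x : ℝ := r ^ ((n : ℝ) * β') with hx
  have hn₀ : (0 : ℝ) ≤ n := n.cast_nonneg
  have hx₀ : 0 < x := Real.rpow_pos_of_pos hr₀ _
  have hx₁ : x ≤ 1 := Real.rpow_le_one_of_one_le_of_nonpos hr.le
    (mul_nonpos_of_nonneg_of_nonpos hn₀ (min_le_right _ _))
  have hxβ : x ≤ r ^ ((n : ℝ) * β) := Real.rpow_le_rpow_of_exponent_le hr.le
    (mul_le_mul_of_nonneg_left (min_le_left _ _) hn₀)
  have hbern : (2 : ℝ) ^ (-x) ≤ 1 - x / 2 := by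
    have h := rpow_one_add_le_one_add_mul_self (s := -(1 / 2)) (by norm_num) hx₀.le hx₁
    have h' : (1 + -(1 / 2) : ℝ) = 2⁻¹ := by norm_num
    rw [h', Real.inv_rpow two_pos.le, ← Real.rpow_neg two_pos.le] at h
    linarith
  have hqn : r ^ ((n : ℝ) * γ) = (r ^ γ) ^ n := by
    rw [mul_comm, Real.rpow_mul_natCast hr₀.le]
  have hVx : V n < x / 2 := by
    refine hn.trans_lt ?_
    have hx2 : x / 2 = (2 : ℝ) ^ (Real.logb 2 r * (n * β') - 1) := by
      rw [Real.rpow_sub two_pos, Real.rpow_one, Real.rpow_mul two_pos.le,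
        Real.rpow_logb two_pos (by norm_num) hr₀]
    rw [hx2]
    refine Real.rpow_lt_rpow_of_exponent_lt one_lt_two ?_
    rw [hqn]
    have hpos : 0 < (r ^ γ) ^ n := by positivity
    rw [pow_zero, pow_one, mul_div_assoc', ← add_div, div_lt_one hpos] at hlt
    linarith
  calc (2 : ℝ) ^ (-(r ^ ((n : ℝ) * β))) ≤ 2 ^ (-x) :=
        Real.rpow_le_rpow_of_exponent_le one_le_two (neg_le_neg hxβ)
    _ ≤ 1 - x / 2 := hbern
    _ < 1 - V n := by linarith

/-! ### The random tree process -/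

namespace BDMC

/-- Separates the past from the new choice `B n`, so that measurability and conditional expectation
concern real functionals only and no σ-algebra on channels is needed. -/
theorem tree_succ_eq_sum {Ω : Type v} {ℓ : ℕ} (B : ℕ → Ω → Fin ℓ) (W : BDMC.{u})
    (G : Matrix (Fin ℓ) (Fin ℓ) (ZMod 2)) (f : BDMC.{u} → ℝ) (n : ℕ) (ω : Ω) :
    f (W.tree G (fun k => B k ω) (n + 1)) =
      ∑ i, f ((W.tree G (fun k => B k ω) n).split G i) *
        Set.indicator {ω | B n ω = i} (fun _ => (1 : ℝ)) ω := by
  rw [Finset.sum_eq_single (B n ω)]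
  · simp [tree]
  · intro i _ hi
    rw [Set.indicator_of_notMem (show ω ∉ {ω | B n ω = i} from fun h => hi (Eq.symm h)), mul_zero]
  · simp

end BDMC

namespace IsUniformIID

variable {Ω : Type v} [mΩ : MeasurableSpace Ω] {μ : Measure Ω} {ℓ : ℕ}
  {B : ℕ → Ω → Fin ℓ}

/-- The filtration whose `n`-th σ-algebra is generated by the first `n` branch choices. -/
def filtration (hB : IsUniformIID μ B) : Filtration ℕ mΩ where
  seq n := ⨆ k ∈ Set.Iio n, MeasurableSpace.comap (B k) inferInstance
  mono' _ _ hmn := biSup_mono fun _ hk => lt_of_lt_of_le hk hmn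
  le' _ := iSup₂_le fun k _ => (hB.measurable k).comap_le

theorem measurableSet_filtration (hB : IsUniformIID μ B) {k n : ℕ} (hk : k < n) (i : Fin ℓ) :
    MeasurableSet[hB.filtration n] {ω | B k ω = i} := by
  have h : MeasurableSpace.comap (B k) inferInstance ≤ hB.filtration n :=
    le_iSup₂_of_le (f := fun k (_ : k ∈ Set.Iio n) => MeasurableSpace.comap (B k) inferInstance)
      k hk le_rfl
  exact h _ ⟨{i}, measurableSet_singleton i, rfl⟩

theorem indep_filtration (hB : IsUniformIID μ B) (n : ℕ) :
    Indep (MeasurableSpace.comap (B n) inferInstance) (hB.filtration n) μ := by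
  have h := indep_iSup_of_disjoint (fun k => (hB.measurable k).comap_le) hB.indep.iIndep
    (S := {n}) (T := Set.Iio n) (by simp)
  simp only [Set.mem_singleton_iff, iSup_iSup_eq_left] at h
  exact h

variable {W : BDMC.{u}} {G : Matrix (Fin ℓ) (Fin ℓ) (ZMod 2)}

theorem measurable_tree (hB : IsUniformIID μ B) (f : BDMC.{u} → ℝ) (n : ℕ) :
    Measurable[hB.filtration n] fun ω => f (W.tree G (fun k => B k ω) n) := by
  induction n generalizing f with
  | zero =>
    exact @measurable_const ℝ Ω _ (hB.filtration 0) (f W)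
  | succ n ih =>
    simp_rw [BDMC.tree_succ_eq_sum B W G f n]
    refine Finset.measurable_sum _ fun i _ => Measurable.mul ?_ ?_
    · exact (ih fun V => f (V.split G i)).mono (hB.filtration.mono n.le_succ) le_rfl
    · exact measurable_const.indicator (hB.measurableSet_filtration n.lt_succ_self i)

variable [IsProbabilityMeasure μ]

theorem identDistrib (hB : IsUniformIID μ B) (m n : ℕ) : IdentDistrib (B m) (B n) μ μ where
  aemeasurable_fst := (hB.measurable m).aemeasurable
  aemeasurable_snd := (hB.measurable n).aemeasurable
  map_eq := by
    have := Measure.isProbabilityMeasure_map (μ := μ) (hB.measurable m).aemeasurable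
    have := Measure.isProbabilityMeasure_map (μ := μ) (hB.measurable n).aemeasurable
    rw [ext_iff_measureReal_singleton]
    intro i
    rw [map_measureReal_apply (hB.measurable m) (measurableSet_singleton i),
      map_measureReal_apply (hB.measurable n) (measurableSet_singleton i)]
    exact (hB.uniform m i).trans (hB.uniform n i).symm

theorem integral_comp (hB : IsUniformIID μ B) (n : ℕ) (f : Fin ℓ → ℝ) :
    ∫ ω, f (B n ω) ∂μ = 1 / (ℓ : ℝ) * ∑ i, f i := by
  have := Measure.isProbabilityMeasure_map (μ := μ) (hB.measurable n).aemeasurable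
  rw [← integral_map (hB.measurable n).aemeasurable
    (measurable_of_finite f).aestronglyMeasurable, integral_fintype (Integrable.of_finite),
    Finset.mul_sum]
  refine Finset.sum_congr rfl fun i _ => ?_
  rw [map_measureReal_apply (hB.measurable n) (measurableSet_singleton i), smul_eq_mul]
  exact congrArg (· * f i) (hB.uniform n i)

theorem ae_tendsto_average (hB : IsUniformIID μ B) (f : Fin ℓ → ℝ) :
    ∀ᵐ ω ∂μ, Tendsto (fun n : ℕ => (∑ k ∈ Finset.range n, f (B k ω)) / n) atTop
      (𝓝 (1 / (ℓ : ℝ) * ∑ i, f i)) := by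
  have hf : Measurable f := measurable_of_finite f
  have h := strong_law_ae_real (μ := μ) (fun n ω => f (B n ω))
    (Integrable.comp_measurable (Integrable.of_finite) (hB.measurable 0))
    (fun m n hmn => (hB.indep.indepFun hmn).comp hf hf)
    (fun n => (hB.identDistrib n 0).comp hf)
  simpa only [hB.integral_comp] using h

/-- Otherwise the empirical frequency of `i` would tend to `0` instead of `1 / ℓ`. -/
theorem ae_frequently_eq (hB : IsUniformIID μ B) (i : Fin ℓ) :
    ∀ᵐ ω ∂μ, ∃ᶠ n in atTop, B n ω = i := by
  filter_upwards [hB.ae_tendsto_average fun j => if j = i then 1 else 0] with ω hω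
  intro hev
  obtain ⟨N, hN⟩ := eventually_atTop.1 hev
  have hpos : (0 : ℝ) < ℓ := by exact_mod_cast i.pos
  have h0 : Tendsto (fun n : ℕ => (∑ k ∈ Finset.range n, if B k ω = i then (1 : ℝ) else 0) / n)
      atTop (𝓝 0) := by
    refine (tendsto_const_div_atTop_nhds_zero_nat
      (∑ k ∈ Finset.range N, if B k ω = i then (1 : ℝ) else 0)).congr' ?_
    filter_upwards [eventually_ge_atTop N] with n hn
    rw [Finset.eventually_constant_sum (fun k hk => if_neg (hN k hk)) hn]
  have h1 := tendsto_nhds_unique h0 hω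
  simp only [Finset.sum_ite_eq', Finset.mem_univ, if_true, mul_one] at h1
  have : 0 < 1 / (ℓ : ℝ) := by positivity
  linarith

theorem condExp_indicator (hB : IsUniformIID μ B) (n : ℕ) (i : Fin ℓ) :
    μ[Set.indicator {ω | B n ω = i} (fun _ => (1 : ℝ)) | hB.filtration n] =ᵐ[μ]
      fun _ => 1 / (ℓ : ℝ) := by
  have hset : MeasurableSet[MeasurableSpace.comap (B n) inferInstance] {ω | B n ω = i} :=
    ⟨{i}, measurableSet_singleton i, rfl⟩
  have h := condExp_indep_eq (μ := μ) (f := Set.indicator {ω | B n ω = i} fun _ => (1 : ℝ))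
    (hB.measurable n).comap_le (hB.filtration.le n)
    ((stronglyMeasurable_const (b := (1 : ℝ))).indicator hset) (hB.indep_filtration n)
  refine h.trans (Eventually.of_forall fun _ => ?_)
  beta_reduce
  rw [integral_indicator_const _ ((hB.measurable n).comap_le _ hset), hB.uniform, smul_eq_mul,
    mul_one]

theorem integrable_tree (hB : IsUniformIID μ B) {f : BDMC.{u} → ℝ} {c : ℝ}
    (hf : ∀ V, |f V| ≤ c) (n : ℕ) :
    Integrable (fun ω => f (W.tree G (fun k => B k ω) n)) μ :=
  Integrable.of_bound
    ((hB.measurable_tree f n).mono (hB.filtration.le n) le_rfl).aestronglyMeasurable c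
    (Eventually.of_forall fun _ => hf _)

/-- A bounded functional of the channel that is preserved on average by `split` is a martingale
along the tree process. -/
theorem martingale_tree (hB : IsUniformIID μ B) {f : BDMC.{u} → ℝ} {c : ℝ}
    (hf : ∀ V, |f V| ≤ c) (hsplit : ∀ V : BDMC.{u}, ∑ i, f (V.split G i) = ℓ * f V)
    (hℓ : ℓ ≠ 0) :
    Martingale (fun n ω => f (W.tree G (fun k => B k ω) n)) hB.filtration μ := by
  refine martingale_nat (fun n => (hB.measurable_tree f n).stronglyMeasurable)
    (fun n => hB.integrable_tree hf n) fun n => ?_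
  set g : Fin ℓ → Ω → ℝ := fun i ω => f ((W.tree G (fun k => B k ω) n).split G i) with hg
  set s : Fin ℓ → Ω → ℝ := fun i => Set.indicator {ω | B n ω = i} fun _ => (1 : ℝ) with hs
  have hgm : ∀ i, StronglyMeasurable[hB.filtration n] (g i) := fun i =>
    (hB.measurable_tree (fun V => f (V.split G i)) n).stronglyMeasurable
  have hset : ∀ i, MeasurableSet {ω | B n ω = i} := fun i =>
    hB.measurable n (measurableSet_singleton i)
  have hsi : ∀ i, Integrable (s i) μ := fun i =>
    (integrable_const (1 : ℝ)).indicator (hset i)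
  have hgs : ∀ i, Integrable (g i * s i) μ := fun i => by
    refine (hsi i).bdd_mul (c := c) ((hgm i).mono (hB.filtration.le n)).aestronglyMeasurable
      (Eventually.of_forall fun _ => hf _)
  have hsum : (fun ω => f (W.tree G (fun k => B k ω) (n + 1))) = ∑ i, g i * s i := by
    funext ω
    rw [BDMC.tree_succ_eq_sum B W G f n, Finset.sum_apply]
    rfl
  have hce : ∀ i, μ[g i * s i | hB.filtration n] =ᵐ[μ] fun ω => g i ω * (1 / (ℓ : ℝ)) := fun i => by
    filter_upwards [condExp_mul_of_stronglyMeasurable_left (hgm i) (hgs i) (hsi i),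
      hB.condExp_indicator n i] with ω h1 h2
    rw [h1, Pi.mul_apply, h2]
  rw [hsum]
  filter_upwards [condExp_finsetSum (s := Finset.univ) (fun i _ => hgs i) (hB.filtration n),
    ae_all_iff.2 hce] with ω h1 h2
  have hℓ' : (ℓ : ℝ) ≠ 0 := by exact_mod_cast hℓ
  rw [h1, Finset.sum_apply, Finset.sum_congr rfl fun i _ => h2 i, ← Finset.sum_mul]
  simp only [hg]
  rw [hsplit]
  field_simp

/-- The mutual information converges along the tree process; if the limit is `0` or `1`, then it
is `1` with probability `I(W)`. -/
theorem exists_limit_mutualInfo (hB : IsUniformIID μ B) (hℓ : ℓ ≠ 0) (hG : IsUnit G) :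
    ∃ J : Ω → ℝ, Measurable J ∧
      (∀ᵐ ω ∂μ, Tendsto (fun n => (W.tree G (fun k => B k ω) n).mutualInfo) atTop (𝓝 (J ω))) ∧
      ((∀ᵐ ω ∂μ, J ω = 0 ∨ J ω = 1) → μ.real {ω | J ω = 1} = W.mutualInfo) := by
  have hbd : ∀ V : BDMC.{u}, |V.mutualInfo| ≤ 1 := fun V => by
    rw [abs_of_nonneg V.mutualInfo_nonneg]; exact V.mutualInfo_le_one
  have hM : Martingale (fun n ω => (W.tree G (fun k => B k ω) n).mutualInfo) hB.filtration μ :=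
    hB.martingale_tree hbd (fun V => V.sum_mutualInfo_split hG) hℓ
  set M : ℕ → Ω → ℝ := fun n ω => (W.tree G (fun k => B k ω) n).mutualInfo with hMdef
  have hconv := hM.submartingale.ae_tendsto_limitProcess (R := 1) fun n => by
    refine (eLpNorm_le_of_ae_bound (C := 1) (Eventually.of_forall fun ω => hbd _)).trans ?_
    simp
  have hJm : Measurable (hB.filtration.limitProcess M μ) :=
    Filtration.stronglyMeasurable_limit_process'.measurable
  refine ⟨hB.filtration.limitProcess M μ, hJm, hconv, fun h01 => ?_⟩
  set J := hB.filtration.limitProcess M μ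
  have hA : MeasurableSet {ω | J ω = 1} := hJm (measurableSet_singleton 1)
  have h1 : Tendsto (fun n => ∫ ω, M n ω ∂μ) atTop (𝓝 (∫ ω, J ω ∂μ)) :=
    tendsto_integral_of_dominated_convergence (fun _ => 1)
      (fun n => (hM.integrable n).aestronglyMeasurable) (integrable_const 1)
      (fun n => Eventually.of_forall fun ω => hbd _) hconv
  have h2 : ∀ n, ∫ ω, M n ω ∂μ = W.mutualInfo := by
    intro n
    have h := hM.setIntegral_eq (i := 0) (j := n) (Nat.zero_le n) MeasurableSet.univ
    rw [setIntegral_univ, setIntegral_univ] at h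
    rw [← h]
    simp [hMdef, BDMC.tree]
  simp_rw [h2] at h1
  -- A limit with values in `{0, 1}` is an indicator, so its mean is a probability.
  have h3 : ∫ ω, J ω ∂μ = μ.real {ω | J ω = 1} := by
    rw [← integral_indicator_one hA]
    refine integral_congr_ae ?_
    filter_upwards [h01] with ω hω
    rcases hω with h | h
    · rw [Set.indicator_of_notMem (by simp [h]), h]
    · rw [Set.indicator_of_mem (show ω ∈ {ω | J ω = 1} from h), h, Pi.one_apply]
  rw [← h3]
  exact tendsto_nhds_unique h1 tendsto_const_nhds

end IsUniformIID

/-! ### The zero-one limit and the final assembly -/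

theorem tendsto_zero_of_bscCapacity_le {ι : Type*} {F : Filter ι} {T I : ι → ℝ}
    (hT₀ : ∀ n, 0 ≤ T n) (hT₁ : ∀ n, T n ≤ 1) (h : ∀ n, bscCapacity (T n) ≤ I n)
    (hI : Tendsto I F (𝓝 0)) : Tendsto T F (𝓝 0) := by
  rw [tendsto_order]
  refine ⟨fun a ha => Eventually.of_forall fun n => ha.trans_le (hT₀ n), fun a ha => ?_⟩
  filter_upwards [hI.eventually_lt_const (bscCapacity_pos ha.ne')] with n hn
  by_contra! hle
  have := bscCapacity_mono (s := a) (t := T n)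
    (by rwa [abs_of_nonneg ha.le, abs_of_nonneg (hT₀ n)])
    (by rw [abs_of_nonneg (hT₀ n)]; exact hT₁ n)
  linarith [h n]

/-- For `J` in `(0, 1)` the ratios `I (n + 1) / I n` tend to `1`. They bound `T n` from below
infinitely often, so `bscCapacity (T n)` comes close to `1` there, exceeding `I n`, whose limit is
`J < 1`. -/
theorem eq_zero_or_eq_one_of_frequently_le {T I : ℕ → ℝ} {J : ℝ} (hI₀ : ∀ n, 0 ≤ I n)
    (hI₁ : ∀ n, I n ≤ 1) (hT₁ : ∀ n, T n ≤ 1) (h : ∀ n, bscCapacity (T n) ≤ I n)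
    (hI : Tendsto I atTop (𝓝 J)) (hfreq : ∃ᶠ n in atTop, I (n + 1) ≤ T n * I n) :
    J = 0 ∨ J = 1 := by
  have hJ₀ : 0 ≤ J := ge_of_tendsto' hI hI₀
  have hJ₁ : J ≤ 1 := le_of_tendsto' hI hI₁
  by_contra! hJ
  have hJpos : 0 < J := lt_of_le_of_ne hJ₀ hJ.1.symm
  have hJlt : J < 1 := lt_of_le_of_ne hJ₁ hJ.2
  have hratio : Tendsto (fun n => bscCapacity (I (n + 1) / I n)) atTop (𝓝 1) := by
    have h1 := ((tendsto_add_atTop_iff_nat 1).2 hI).div hI hJpos.ne'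
    rw [div_self hJpos.ne'] at h1
    have h2 := (continuous_bscCapacity.tendsto 1).comp h1
    rwa [bscCapacity_one] at h2
  refine hfreq ?_
  filter_upwards [hI.eventually_lt hratio hJlt, hI.eventually_const_lt hJpos] with n hlt hpos hle
  have h1 : I (n + 1) / I n ≤ T n := (div_le_iff₀ hpos).2 hle
  have h0 : 0 ≤ I (n + 1) / I n := div_nonneg (hI₀ _) (hI₀ _)
  have h2 := bscCapacity_mono (s := I (n + 1) / I n) (t := T n)
    (by rwa [abs_of_nonneg h0, abs_of_nonneg (h0.trans h1)])
    (by rw [abs_of_nonneg (h0.trans h1)]; exact hT₁ n)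
  linarith [h n]

theorem tendsto_measureReal_of_ae_eventually_iff {Ω : Type*} [MeasurableSpace Ω] {μ : Measure Ω}
    [IsFiniteMeasure μ] {s : ℕ → Set Ω} {t : Set Ω} (hs : ∀ n, MeasurableSet (s n))
    (ht : MeasurableSet t) (h : ∀ᵐ ω ∂μ, ∀ᶠ n in atTop, ω ∈ s n ↔ ω ∈ t) :
    Tendsto (fun n => μ.real (s n)) atTop (𝓝 (μ.real t)) :=
  (ENNReal.tendsto_toReal (measure_ne_top μ t)).comp
    (tendsto_measure_of_ae_tendsto_indicator_of_isFiniteMeasure atTop ht hs h)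

namespace IsUniformIID

variable {Ω : Type v} [mΩ : MeasurableSpace Ω] {μ : Measure Ω} [IsProbabilityMeasure μ] {ℓ : ℕ}
  {B : ℕ → Ω → Fin ℓ} {W : BDMC.{u}} {G : Matrix (Fin ℓ) (Fin ℓ) (ZMod 2)}

theorem measurable_bhattacharyyaProcess (hB : IsUniformIID μ B) (n : ℕ) :
    Measurable (bhattacharyyaProcess B W G n) :=
  (hB.measurable_tree BDMC.bhattacharyya n).mono (hB.filtration.le n) le_rfl

theorem ae_eventually_rateThreshold_le (hB : IsUniformIID μ B) (hℓ : 2 ≤ ℓ)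
    (hI : W.mutualInfo < 1) (hG : IsUnit G) {β : ℝ} (hβ : polarExponent G < β) :
    ∀ᵐ ω ∂μ, ∀ᶠ n in atTop, rateThreshold ℓ β n ≤ bhattacharyyaProcess B W G n ω := by
  have hr : (1 : ℝ) < ℓ := by exact_mod_cast hℓ
  filter_upwards [hB.ae_tendsto_average fun i => Real.logb ℓ (partialDistance G i)] with ω hω
  exact eventually_two_rpow_le_of_pow_le (Z := fun n => bhattacharyyaProcess B W G n ω)
    (d := fun n => partialDistance G (B n ω)) hr (fun n => one_le_partialDistance hG _)
    (W.bhattacharyya_pos hI)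
    (fun n => BDMC.pow_partialDistance_le_bhattacharyya_split _ G (B n ω)) hω hβ

/-- Almost surely, the mutual information tends to `1` and the Bhattacharyya parameter falls below
every threshold of rate less than the exponent, or the mutual information tends to `0` and the
Bhattacharyya parameter stays above every threshold. -/
theorem exists_measurableSet_polarization (hB : IsUniformIID μ B) (hℓ : 2 ≤ ℓ) (hG : IsUnit G)
    (hE : 0 < polarExponent G) :
    ∃ A : Set Ω, MeasurableSet A ∧ μ.real A = W.mutualInfo ∧
      ∀ β < polarExponent G, ∀ᵐ ω ∂μ, ∀ᶠ n in atTop,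
        bhattacharyyaProcess B W G n ω ≤ rateThreshold ℓ β n ↔ ω ∈ A := by
  have hr : (1 : ℝ) < ℓ := by exact_mod_cast hℓ
  obtain ⟨i, k₀, k₁, a₀, a₁, hk, h₀, hi₀, hu₀, h₁, hi₁, hu₁⟩ := exists_two_unit_vectors hG hE.ne'
  obtain ⟨J, hJm, hJ, hJμ⟩ := hB.exists_limit_mutualInfo (W := W) (by omega : ℓ ≠ 0) hG
  have h01 : ∀ᵐ ω ∂μ, J ω = 0 ∨ J ω = 1 := by
    filter_upwards [hJ, hB.ae_frequently_eq i] with ω hω hfreq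
    refine eq_zero_or_eq_one_of_frequently_le
      (T := fun n => (W.tree G (fun k => B k ω) n).totalVariation)
      (fun n => BDMC.mutualInfo_nonneg _) (fun n => BDMC.mutualInfo_le_one _)
      (fun n => BDMC.totalVariation_le_one _) (fun n => BDMC.bscCapacity_totalVariation_le _) hω
      (hfreq.mono fun n hn => ?_)
    subst hn
    exact BDMC.mutualInfo_split_le _ hG hk h₀ hi₀ hu₀ h₁ hi₁ hu₁
  refine ⟨{ω | J ω = 1}, hJm (measurableSet_singleton 1), hJμ h01, fun β hβ => ?_⟩
  -- For `1 - Z` only row `i` is known to square, the others are at worst linear; the mean exponent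
  -- `(log_ℓ 2) / ℓ` is still positive, which suffices.
  set d : Fin ℓ → ℕ := fun j => if j = i then 2 else 1 with hd
  have hγ : 0 < 1 / (ℓ : ℝ) * ∑ j, Real.logb ℓ (d j) := by
    have h2 : ∑ j, Real.logb ℓ (d j) = Real.logb ℓ 2 := by
      rw [Finset.sum_eq_single i] <;> simp +contextual [hd]
    rw [h2]
    have := Real.logb_pos hr one_lt_two
    positivity
  filter_upwards [hJ, h01, hB.ae_tendsto_average fun j => Real.logb ℓ (partialDistance G j),
    hB.ae_tendsto_average fun j => Real.logb ℓ (d j)] with ω hω hω01 hD hd'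
  set V : ℕ → BDMC.{u} := fun n => W.tree G (fun k => B k ω) n with hV
  have hZ : ∀ n, bhattacharyyaProcess B W G n ω = (V n).bhattacharyya := fun _ => rfl
  have hsucc : ∀ n, V (n + 1) = (V n).split G (B n ω) := fun _ => rfl
  rcases hω01 with h | h
  · rw [h] at hω
    have hT : Tendsto (fun n => (V n).totalVariation) atTop (𝓝 0) :=
      tendsto_zero_of_bscCapacity_le (fun n => (V n).totalVariation_nonneg)
        (fun n => (V n).totalVariation_le_one) (fun n => (V n).bscCapacity_totalVariation_le) hω
    have hX₀ : ∀ n, 0 ≤ 1 - (V n).bhattacharyya := fun n => by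
      linarith [(V n).bhattacharyya_le_one]
    have hX : Tendsto (fun n => 1 - (V n).bhattacharyya) atTop (𝓝 0) :=
      squeeze_zero hX₀ (fun n => (V n).one_sub_bhattacharyya_le_totalVariation) hT
    have hrec : ∀ n, 1 - (V (n + 1)).bhattacharyya ≤
        max 4 (ℓ : ℝ) * (1 - (V n).bhattacharyya) ^ d (B n ω) := by
      intro n
      rw [hsucc]
      by_cases hBi : B n ω = i
      · rw [hBi]
        simp only [hd, if_true]
        refine ((V n).one_sub_bhattacharyya_split_le_sq hG hk h₀ hi₀ hu₀ h₁ hi₁ hu₁).trans ?_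
        exact mul_le_mul_of_nonneg_right (le_max_left _ _) (sq_nonneg _)
      · simp only [hd, if_neg hBi, pow_one]
        refine ((V n).one_sub_bhattacharyya_split_le G _).trans ?_
        exact mul_le_mul_of_nonneg_right (le_max_right _ _) (hX₀ n)
    have hdecay := eventually_le_two_rpow_of_le_mul_pow hr
      (le_max_of_le_right hr.le) (fun n => by simp only [hd]; split_ifs <;> norm_num)
      hX₀ hrec hX hd' (half_lt_self hγ)
    filter_upwards [eventually_lt_one_sub_of_le_two_rpow hr (half_pos hγ) hdecay β] with n hn
    rw [sub_sub_cancel] at hn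
    have hne : ¬ J ω = 1 := by simp [h]
    simp only [hne, iff_false, not_le, hZ]
    exact hn
  · rw [h] at hω
    have hT : Tendsto (fun n => (V n).totalVariation) atTop (𝓝 1) :=
      tendsto_of_tendsto_of_tendsto_of_le_of_le hω tendsto_const_nhds
        (fun n => (V n).mutualInfo_le_totalVariation) fun n => (V n).totalVariation_le_one
    have hlim : Tendsto (fun n => (V n).bhattacharyya) atTop (𝓝 0) := by
      have hsq : Tendsto (fun n => √(1 - (V n).totalVariation ^ 2)) atTop (𝓝 0) := by
        have h1 := ((tendsto_const_nhds (x := (1 : ℝ))).sub (hT.pow 2)).sqrt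
        simpa using h1
      refine squeeze_zero (fun n => (V n).bhattacharyya_nonneg) (fun n => ?_) hsq
      exact Real.le_sqrt_of_sq_le
        (by linarith [(V n).bhattacharyya_sq_add_totalVariation_sq_le])
    have hev := eventually_le_two_rpow_of_le_mul_pow hr
      (one_le_pow₀ one_le_two : (1 : ℝ) ≤ 2 ^ ℓ)
      (fun n => one_le_partialDistance hG (B n ω)) (fun n => (V n).bhattacharyya_nonneg)
      (fun n => (V n).bhattacharyya_split_le G (B n ω)) hlim hD hβ
    filter_upwards [hev] with n hn
    exact iff_of_true hn h

end IsUniformIID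

end

theorem theorem3 {Ω : Type v} [MeasurableSpace Ω] (μ : Measure Ω) [IsProbabilityMeasure μ]
    {ℓ : ℕ} (hℓ : 2 ≤ ℓ) (B : ℕ → Ω → Fin ℓ) (hB : IsUniformIID μ B)
    (W : BDMC.{u}) (hW : W.IsSymmetric) (hI₀ : 0 < W.mutualInfo) (hI₁ : W.mutualInfo < 1)
    (G : Matrix (Fin ℓ) (Fin ℓ) (ZMod 2)) (hG : IsUnit G) :
    (0 < polarExponent G → HasRateOfPolarization μ B W G (polarExponent G)) ∧
    (∀ β : ℝ, polarExponent G < β →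
      Tendsto (fun n => μ.real {ω | rateThreshold ℓ β n ≤ bhattacharyyaProcess B W G n ω})
        atTop (𝓝 1)) := by
  -- Only the one-step lower bound on `Z` enters, without polarization, so the case `E(G) = 0` is
  -- included.
  have hconverse : ∀ β : ℝ, polarExponent G < β →
      Tendsto (fun n => μ.real {ω | rateThreshold ℓ β n ≤ bhattacharyyaProcess B W G n ω})
        atTop (𝓝 1) := by
    intro β hβ
    have h := tendsto_measureReal_of_ae_eventually_iff (μ := μ)
      (s := fun n => {ω | rateThreshold ℓ β n ≤ bhattacharyyaProcess B W G n ω})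
      (t := Set.univ)
      (fun n => measurableSet_le measurable_const (hB.measurable_bhattacharyyaProcess n))
      MeasurableSet.univ (by
        filter_upwards [hB.ae_eventually_rateThreshold_le hℓ hI₁ hG hβ] with ω hω
        filter_upwards [hω] with n hn
        exact iff_of_true hn (Set.mem_univ ω))
    rwa [probReal_univ] at h
  refine ⟨fun hE => ⟨fun β hβ => ?_, hconverse⟩, hconverse⟩
  obtain ⟨A, hA, hAμ, hlim⟩ := hB.exists_measurableSet_polarization (W := W) hℓ hG hE
  rw [← hAμ]
  exact tendsto_measureReal_of_ae_eventually_iff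
    (fun n => measurableSet_le (hB.measurable_bhattacharyyaProcess n) measurable_const) hA
    (hlim β hβ)
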